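/- Let $(A,\Delta)$ be an algebraic quantum group over $\mathbb C$, that is, a regular multiplier Hopf algebra with a non-zero left integral $\varphi$. Explicitly: $A$ is a (not necessarily unital) associative $\mathbb C$-algebra with non-degenerate product; $\Delta:A\to M(A\otimes A)$ is a coassociative homomorphism into the multiplier algebra such that the four maps sending $a\otimes a'$ to $\Delta(a)(1\otimes a')$, $(a\otimes 1)\Delta(a')$, $\Delta(a)(a'\otimes 1)$ and $(1\otimes a)\Delta(a')$ are bijections of $A\otimes A$ onto itself; and $\varphi:A\to\mathbb C$ is a non-zero linear functional with $(\iota\otimes\varphi)\Delta(a)=\varphi(a)1$ for all $a\in A$. Let $B=\widehat A=\{\varphi(\,\cdot\,c): c\in A\}$ be its dual, paired with $A$ by evaluation, $\langle a,b\rangle=b(a)$. The product and the coproduct $\Delta:B\to M(B\otimes B)$ of $B$ are given by $$\langle a,bb'\rangle=\langle\Delta(a),b\otimes b'\rangle,\qquad \langle a\otimes a',\Delta(b)\rangle=\langle aa',b\rangle .$$ Here and below, a pairing $\langle x,y\rangle$ of an algebra $X$ with a space $Y$ is extended to multipliers $n\in M(X)$ by $\langle n,x\triangleright y\rangle=\langle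 nx,y\rangle$ and $\langle n,y\triangleleft x\rangle=\langle xn,y\rangle$, where $\langle x',x\triangleright y\rangle=\langle x'x,y\rangle$ and $\langle x',y\triangleleft x\rangle=\langle xx',y\rangle$. Let $S$ denote the antipode of $A$, and also that of $B$. There is a unique element $V\in M(B\otimes A)$ (the duality) such that $\langle V,a\otimes b\rangle=\langle a,b\rangle$ for all $a\in A$ and $b\in B$. For all $a\in A$, $b\in B$ the multipliers $(b\otimes 1)V(1\otimes a)$ and $(1\otimes a)V(b\otimes 1)$ lie in $B\otimes A$, and there are unique elements $(S\otimes\iota)V$ and $(\iota\otimes S)V$ of $M(B\otimes A)$ such that, for all $a\in A$ and $b\in B$, $$((S\otimes\iota)V)(S(b)\otimes a)=(S\otimes\iota)\big((b\otimes1)V(1\otimes a)\big),\qquad (S(b)\otimes a)((S\otimes\iota)V)=(S\otimes\iota)\big((1\otimes a)V(b\otimes1)\big),$$ $$((\iota\otimes S)V)(b\otimes S(a))=(\iota\otimes S)\big((1\otimes a)V(b\otimes1)\big),\qquad (b\otimes S(a))((\iota\otimes S)V)=(\iota\otimes S)\big((b\otimes1)V(1\otimes a)\big).$$ The element $V$ is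 invertible in $M(B\otimes A)$, and $$V^{-1}=(S\otimes\iota)V=(\iota\otimes S)V .$$ -/

import Mathlib

open scoped TensorProduct

noncomputable section

namespace AQG

/-! ### Multiplier algebras of non-unital complex algebras -/

section Multiplier

variable (A : Type*) [NonUnitalRing A] [Module ℂ A] [IsScalarTower ℂ A A] [SMulCommClass ℂ A A]

/-- The multiplier algebra `M(A)`, as an algebra of pairs `(L, R)` of linear maps of `A` with
`a (L b) = (R a) b`. We think of `L` as `b ↦ m b` and of `R` as `a ↦ a m`, so the
product of `(L, R)` and `(L', R')` is `(L ∘ L', R' ∘ R)`. -/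
def multiplierSubalgebra : Subalgebra ℂ (Module.End ℂ A × (Module.End ℂ A)ᵐᵒᵖ) where
  carrier := {p | ∀ a b : A, a * p.1 b = p.2.unop a * b}
  mul_mem' := by
    intro p q hp hq a b
    simp only [Set.mem_ofPred_eq] at hp hq
    simp [hp, hq]
  add_mem' := by
    intro p q hp hq a b
    simp only [Set.mem_ofPred_eq] at hp hq
    simp [hp, hq, mul_add, add_mul]
  algebraMap_mem' := by
    intro r a b
    simp [Algebra.algebraMap_eq_smul_one, mul_smul_comm, smul_mul_assoc]

/-- The multiplier algebra `M(A)`. -/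
def Multiplier : Type _ := multiplierSubalgebra A

instance : Ring (Multiplier A) := inferInstanceAs (Ring (multiplierSubalgebra A))

instance : Algebra ℂ (Multiplier A) := inferInstanceAs (Algebra ℂ (multiplierSubalgebra A))

variable {A}

/-- The element `m b` of `A`, for `m ∈ M(A)` and `b ∈ A`, as a linear map in `b`. -/
def Multiplier.left (m : Multiplier A) : A →ₗ[ℂ] A := m.1.1

/-- The element `a m` of `A`, for `m ∈ M(A)` and `a ∈ A`, as a linear map in `a`. -/
def Multiplier.right (m : Multiplier A) : A →ₗ[ℂ] A := m.1.2.unop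

/-- The canonical embedding `A → M(A)`. -/
def Multiplier.of (a : A) : Multiplier A :=
  ⟨(LinearMap.mulLeft ℂ a, MulOpposite.op (LinearMap.mulRight ℂ a)),
    fun x y => by simp [mul_assoc]⟩

variable {B : Type*} [NonUnitalRing B] [Module ℂ B] [IsScalarTower ℂ B B] [SMulCommClass ℂ B B]

/-- The multiplier `m ⊗ n` of `A ⊗ B`, for `m ∈ M(A)` and `n ∈ M(B)`. -/
def Multiplier.tmul (m : Multiplier A) (n : Multiplier B) : Multiplier (A ⊗[ℂ] B) :=
  ⟨(TensorProduct.map m.left n.left, MulOpposite.op (TensorProduct.map m.right n.right)), by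
    have hm : ∀ a b : A, a * m.left b = m.right a * b := m.2
    have hn : ∀ a b : B, a * n.left b = n.right a * b := n.2
    intro x y
    induction x with
    | zero => simp
    | add x x' hx hx' => simp only [MulOpposite.unop_op] at hx hx' ⊢; simp [add_mul, hx, hx']
    | tmul a b =>
      induction y with
      | zero => simp
      | add y y' hy hy' => simp only [MulOpposite.unop_op] at hy hy' ⊢; simp [mul_add, hy, hy']
      | tmul c d => simp [hm, hn]⟩

end Multiplier

/-! ### Regular multiplier Hopf algebras and integrals -/

section Slices

variable {X Y : Type*} [AddCommGroup X] [Module ℂ X] [AddCommGroup Y] [Module ℂ Y]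

/-- The map `ι ⊗ f : X ⊗ Y → X` for a linear functional `f` on `Y`. -/
def sliceRight (f : Module.Dual ℂ Y) : X ⊗[ℂ] Y →ₗ[ℂ] X :=
  (TensorProduct.rid ℂ X).toLinearMap ∘ₗ f.lTensor X

/-- The map `f ⊗ ι : X ⊗ Y → Y` for a linear functional `f` on `X`. -/
def sliceLeft (f : Module.Dual ℂ X) : X ⊗[ℂ] Y →ₗ[ℂ] Y :=
  (TensorProduct.lid ℂ Y).toLinearMap ∘ₗ f.rTensor Y

@[simp] theorem sliceRight_tmul (f : Module.Dual ℂ Y) (x : X) (y : Y) :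
    sliceRight f (x ⊗ₜ[ℂ] y) = f y • x := by simp [sliceRight]

@[simp] theorem sliceLeft_tmul (f : Module.Dual ℂ X) (x : X) (y : Y) :
    sliceLeft f (x ⊗ₜ[ℂ] y) = f x • y := by simp [sliceLeft]

end Slices

/-- A regular multiplier Hopf algebra structure on the (possibly non-unital) algebra `A`:
the product is non-degenerate, `Δ : A → M(A ⊗ A)` is a homomorphism, and the four canonical maps
* `T₁ (a ⊗ b) = Δ(a)(1 ⊗ b)`,
* `T₂ (a ⊗ b) = (a ⊗ 1)Δ(b)`,
* `T₃ (a ⊗ b) = Δ(a)(b ⊗ 1)`,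
* `T₄ (a ⊗ b) = (1 ⊗ a)Δ(b)`

take values in `A ⊗ A` and are bijections of `A ⊗ A` onto itself. Bijectivity of `T₁` and `T₂`
is the definition of a multiplier Hopf algebra; bijectivity of `T₃` and `T₄` is the same requirement
for the flipped coproduct, that is, regularity. The maps `Tᵢ` are determined by `Δ`.
Coassociativity is
`(a ⊗ 1 ⊗ 1)(Δ ⊗ ι)(Δ(b)(1 ⊗ c)) = (ι ⊗ Δ)((a ⊗ 1)Δ(b))(1 ⊗ 1 ⊗ c)`. -/
structure RegularMultiplierHopfAlgebra (A : Type*) [NonUnitalRing A] [Module ℂ A]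
    [IsScalarTower ℂ A A] [SMulCommClass ℂ A A] where
  eq_zero_of_mul_left : ∀ a : A, (∀ b, a * b = 0) → a = 0
  eq_zero_of_mul_right : ∀ a : A, (∀ b, b * a = 0) → a = 0
  Δ : A →ₙₐ[ℂ] Multiplier (A ⊗[ℂ] A)
  T₁ : (A ⊗[ℂ] A) ≃ₗ[ℂ] (A ⊗[ℂ] A)
  T₂ : (A ⊗[ℂ] A) ≃ₗ[ℂ] (A ⊗[ℂ] A)
  T₃ : (A ⊗[ℂ] A) ≃ₗ[ℂ] (A ⊗[ℂ] A)
  T₄ : (A ⊗[ℂ] A) ≃ₗ[ℂ] (A ⊗[ℂ] A)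
  T₁_spec : ∀ a b, Multiplier.of (T₁ (a ⊗ₜ b)) = Δ a * Multiplier.tmul 1 (Multiplier.of b)
  T₂_spec : ∀ a b, Multiplier.of (T₂ (a ⊗ₜ b)) = Multiplier.tmul (Multiplier.of a) 1 * Δ b
  T₃_spec : ∀ a b, Multiplier.of (T₃ (a ⊗ₜ b)) = Δ a * Multiplier.tmul (Multiplier.of b) 1
  T₄_spec : ∀ a b, Multiplier.of (T₄ (a ⊗ₜ b)) = Multiplier.tmul 1 (Multiplier.of a) * Δ b
  coassoc : ∀ a b c : A,
    TensorProduct.assoc ℂ A A A (T₂.toLinearMap.rTensor A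
      ((TensorProduct.assoc ℂ A A A).symm (a ⊗ₜ T₁ (b ⊗ₜ c)))) =
    T₁.toLinearMap.lTensor A (TensorProduct.assoc ℂ A A A (T₂ (a ⊗ₜ b) ⊗ₜ c))

/-- An algebraic quantum group: a regular multiplier Hopf algebra with a left integral `φ`, that is,
a non-zero linear functional with `(ι ⊗ φ)Δ(a) = φ(a)1` in `M(A)` for all `a`. As an equation
between multipliers, this reads
`(ι ⊗ φ)(Δ(a)(b ⊗ 1)) = φ(a)b` and `(ι ⊗ φ)((b ⊗ 1)Δ(a)) = φ(a)b` for all `a, b`. -/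
structure AlgebraicQuantumGroup (A : Type*) [NonUnitalRing A] [Module ℂ A]
    [IsScalarTower ℂ A A] [SMulCommClass ℂ A A] extends RegularMultiplierHopfAlgebra A where
  φ : Module.Dual ℂ A
  φ_ne_zero : φ ≠ 0
  left_invariant : ∀ a b : A, sliceRight φ (T₃ (a ⊗ₜ b)) = φ a • b
  left_invariant' : ∀ a b : A, sliceRight φ (T₂ (b ⊗ₜ a)) = φ a • b

/-! ### Counit and antipode -/

section Antipode

variable {X : Type*} [NonUnitalRing X] [Module ℂ X] [IsScalarTower ℂ X X] [SMulCommClass ℂ X X]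

/-- `ε` is a counit for the coproduct `Δ`: for all `a, b`, the multipliers `Δ(a)(1 ⊗ b)` and
`(a ⊗ 1)Δ(b)` lie in `X ⊗ X`, and
`(ε ⊗ ι)(Δ(a)(1 ⊗ b)) = ab` and `(ι ⊗ ε)((a ⊗ 1)Δ(b)) = ab`. -/
def IsCounit (Δ : X →ₗ[ℂ] Multiplier (X ⊗[ℂ] X)) (ε : Module.Dual ℂ X) : Prop :=
  (∀ a b : X, ∃ t : X ⊗[ℂ] X,
    Multiplier.of t = Δ a * Multiplier.tmul 1 (Multiplier.of b) ∧ sliceLeft ε t = a * b) ∧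
  (∀ a b : X, ∃ t : X ⊗[ℂ] X,
    Multiplier.of t = Multiplier.tmul (Multiplier.of a) 1 * Δ b ∧ sliceRight ε t = a * b)

/-- `S` is an antipode for the coproduct `Δ`: with `ε` a counit and `m` the multiplication map,
`m(S ⊗ ι)(Δ(a)(1 ⊗ b)) = ε(a)b` and `m(ι ⊗ S)((a ⊗ 1)Δ(b)) = ε(b)a`. -/
def IsAntipode (Δ : X →ₗ[ℂ] Multiplier (X ⊗[ℂ] X)) (S : X →ₗ[ℂ] X) : Prop :=
  ∃ ε : Module.Dual ℂ X, IsCounit Δ ε ∧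
  (∀ a b : X, ∃ t : X ⊗[ℂ] X, Multiplier.of t = Δ a * Multiplier.tmul 1 (Multiplier.of b) ∧
    LinearMap.mul' ℂ X (S.rTensor X t) = ε a • b) ∧
  (∀ a b : X, ∃ t : X ⊗[ℂ] X, Multiplier.of t = Multiplier.tmul (Multiplier.of a) 1 * Δ b ∧
    LinearMap.mul' ℂ X (S.lTensor X t) = ε b • a)

end Antipode

/-! ### Extension of pairings to multipliers -/

section Pairings

variable {X Y X' Y' : Type*} [AddCommGroup X'] [Module ℂ X'] [AddCommGroup Y] [Module ℂ Y]
  [AddCommGroup Y'] [Module ℂ Y']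

/-- The tensor product of two pairings, `⟨x ⊗ x', y ⊗ y'⟩ = ⟨x, y⟩⟨x', y'⟩`. -/
def tensorPairing [AddCommGroup X] [Module ℂ X] (p : X →ₗ[ℂ] Module.Dual ℂ Y)
    (q : X' →ₗ[ℂ] Module.Dual ℂ Y') : (X ⊗[ℂ] X') →ₗ[ℂ] Module.Dual ℂ (Y ⊗[ℂ] Y') :=
  TensorProduct.dualDistrib ℂ Y Y' ∘ₗ TensorProduct.map p q

variable [NonUnitalRing X] [Module ℂ X] [IsScalarTower ℂ X X] [SMulCommClass ℂ X X]

/-- The pairing `p` of the algebra `X` with the space `Y` induces a left and a right action of `X`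
on `Y`. Here `z = x ▷ y`, that is, `⟨x', z⟩ = ⟨x'x, y⟩` for all `x'`. -/
def IsLeftAct (p : X →ₗ[ℂ] Module.Dual ℂ Y) (x : X) (y z : Y) : Prop :=
  ∀ x' : X, p x' z = p (x' * x) y

/-- Here `z = y ◁ x`, that is, `⟨x', z⟩ = ⟨xx', y⟩` for all `x'`. -/
def IsRightAct (p : X →ₗ[ℂ] Module.Dual ℂ Y) (x : X) (y z : Y) : Prop :=
  ∀ x' : X, p x' z = p (x * x') y

/-- The functional `f` on `Y` is the value `⟨n, · ⟩` at the multiplier `n ∈ M(X)` of the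
extension of the pairing of `X` with `Y` to a pairing of `M(X)` with `Y`. This extension is given by
`⟨n, x ▷ y⟩ = ⟨nx, y⟩` and `⟨n, y ◁ x⟩ = ⟨xn, y⟩`. -/
def IsExtendedPairing (p : X →ₗ[ℂ] Module.Dual ℂ Y) (n : Multiplier X) (f : Module.Dual ℂ Y) :
    Prop :=
  (∀ (x : X) (y z : Y), IsLeftAct p x y z → f z = p (n.left x) y) ∧
  (∀ (x : X) (y z : Y), IsRightAct p x y z → f z = p (n.right x) y)

end Pairings

/-! ### Auxiliary facts -/

section Aux

variable {X Y : Type*} [AddCommGroup X] [Module ℂ X] [AddCommGroup Y] [Module ℂ Y]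

theorem eq_zero_of_sliceRight (t : X ⊗[ℂ] Y)
    (h : ∀ f : Module.Dual ℂ Y, sliceRight f t = 0) : t = 0 := by
  classical
  let b := Module.Basis.ofVectorSpace ℂ Y
  apply (TensorProduct.equivFinsuppOfBasisRight (M := X) b).injective
  rw [map_zero]
  ext i
  rw [Finsupp.zero_apply, ← h (b.coord i)]
  clear h
  induction t with
  | zero => simp
  | add s t hs ht => simp [hs, ht]
  | tmul x y => simp

theorem eq_zero_of_sliceLeft (t : X ⊗[ℂ] Y)
    (h : ∀ f : Module.Dual ℂ X, sliceLeft f t = 0) : t = 0 := by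
  apply (TensorProduct.comm ℂ X Y).injective
  rw [map_zero]
  apply eq_zero_of_sliceRight
  intro f
  rw [← h f]
  clear h
  induction t with
  | zero => simp
  | add s t hs ht => simp [hs, ht]
  | tmul x y => simp

theorem eq_zero_of_rTensor {ι : Type*} (g : ι → X →ₗ[ℂ] X)
    (hg : ∀ x, (∀ i, g i x = 0) → x = 0) (t : X ⊗[ℂ] Y)
    (h : ∀ i, (g i).rTensor Y t = 0) : t = 0 := by
  apply eq_zero_of_sliceRight
  intro f
  apply hg
  intro i
  rw [← map_zero (sliceRight f), ← h i]
  clear h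
  induction t with
  | zero => simp
  | add s t hs ht => simp [hs, ht]
  | tmul x y => simp

theorem eq_zero_of_lTensor {ι : Type*} (g : ι → Y →ₗ[ℂ] Y)
    (hg : ∀ x, (∀ i, g i x = 0) → x = 0) (t : X ⊗[ℂ] Y)
    (h : ∀ i, (g i).lTensor X t = 0) : t = 0 := by
  apply eq_zero_of_sliceLeft
  intro f
  apply hg
  intro i
  rw [← map_zero (sliceLeft f), ← h i]
  clear h
  induction t with
  | zero => simp
  | add s t hs ht => simp [hs, ht]
  | tmul x y => simp

end Aux

namespace RegularMultiplierHopfAlgebra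

variable {A : Type*} [NonUnitalRing A] [Module ℂ A] [IsScalarTower ℂ A A] [SMulCommClass ℂ A A]
  (G : RegularMultiplierHopfAlgebra A)

theorem tensor_eq_zero_left (G : RegularMultiplierHopfAlgebra A) (t : A ⊗[ℂ] A)
    (h : ∀ a b : A, t * (a ⊗ₜ b) = 0) : t = 0 := by
  refine eq_zero_of_lTensor (fun b : A => LinearMap.mulRight ℂ b)
    (fun x hx => G.eq_zero_of_mul_left x hx) t fun b => ?_
  refine eq_zero_of_rTensor (fun a : A => LinearMap.mulRight ℂ a)
    (fun x hx => G.eq_zero_of_mul_left x hx) _ fun a => ?_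
  rw [← h a b]
  clear h
  induction t with
  | zero => simp
  | add s t hs ht => simp only [map_add, add_mul, hs, ht]
  | tmul x y => simp

theorem tensor_eq_zero_right (G : RegularMultiplierHopfAlgebra A) (t : A ⊗[ℂ] A)
    (h : ∀ a b : A, (a ⊗ₜ b) * t = 0) : t = 0 := by
  refine eq_zero_of_lTensor (fun b : A => LinearMap.mulLeft ℂ b)
    (fun x hx => G.eq_zero_of_mul_right x hx) t fun b => ?_
  refine eq_zero_of_rTensor (fun a : A => LinearMap.mulLeft ℂ a)
    (fun x hx => G.eq_zero_of_mul_right x hx) _ fun a => ?_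
  rw [← h a b]
  clear h
  induction t with
  | zero => simp
  | add s t hs ht => simp only [map_add, mul_add, hs, ht]
  | tmul x y => simp

theorem left_mul (G : RegularMultiplierHopfAlgebra A) (m : Multiplier (A ⊗[ℂ] A))
    (s t : A ⊗[ℂ] A) : m.left (s * t) = m.left s * t := by
  have hm : ∀ x y, x * m.left y = m.right x * y := m.2
  rw [← sub_eq_zero]
  apply G.tensor_eq_zero_right
  intro a b
  rw [mul_sub, hm, ← mul_assoc (a ⊗ₜ b), hm, mul_assoc, sub_self]

theorem T₁_mul (a b : A) (t : A ⊗[ℂ] A) :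
    G.T₁ (a ⊗ₜ b) * t = (G.Δ a).left ((LinearMap.mulLeft ℂ b).lTensor A t) :=
  congrArg (fun m : Multiplier (A ⊗[ℂ] A) => m.left t) (G.T₁_spec a b)

theorem T₃_mul (a b : A) (t : A ⊗[ℂ] A) :
    G.T₃ (a ⊗ₜ b) * t = (G.Δ a).left ((LinearMap.mulLeft ℂ b).rTensor A t) :=
  congrArg (fun m : Multiplier (A ⊗[ℂ] A) => m.left t) (G.T₃_spec a b)

theorem mul_T₂ (a b : A) (t : A ⊗[ℂ] A) :
    t * G.T₂ (a ⊗ₜ b) = (G.Δ b).right ((LinearMap.mulRight ℂ a).rTensor A t) :=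
  congrArg (fun m : Multiplier (A ⊗[ℂ] A) => m.right t) (G.T₂_spec a b)

theorem Δ_left_tmul (a c c' : A) :
    (G.Δ a).left (c ⊗ₜ c') = (LinearMap.mulRight ℂ c).rTensor A (G.T₁ (a ⊗ₜ c')) := by
  rw [← sub_eq_zero]
  apply G.tensor_eq_zero_left
  intro x y
  have h : (LinearMap.mulRight ℂ c).rTensor A (G.T₁ (a ⊗ₜ c')) * (x ⊗ₜ y) =
      G.T₁ (a ⊗ₜ c') * ((c * x) ⊗ₜ y) := by
    generalize G.T₁ (a ⊗ₜ c') = t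
    induction t with
    | zero => simp
    | add s t hs ht => simp only [map_add, add_mul, hs, ht]
    | tmul u v => simp [mul_assoc]
  rw [sub_mul, h, G.T₁_mul, ← G.left_mul]
  simp

theorem Δ_left_tmul' (a c c' : A) :
    (G.Δ a).left (c ⊗ₜ c') = (LinearMap.mulRight ℂ c').lTensor A (G.T₃ (a ⊗ₜ c)) := by
  rw [← sub_eq_zero]
  apply G.tensor_eq_zero_left
  intro x y
  have h : (LinearMap.mulRight ℂ c').lTensor A (G.T₃ (a ⊗ₜ c)) * (x ⊗ₜ y) =
      G.T₃ (a ⊗ₜ c) * (x ⊗ₜ (c' * y)) := by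
    generalize G.T₃ (a ⊗ₜ c) = t
    induction t with
    | zero => simp
    | add s t hs ht => simp only [map_add, add_mul, hs, ht]
    | tmul u v => simp [mul_assoc]
  rw [sub_mul, h, G.T₃_mul, ← G.left_mul]
  simp

theorem Δ_left_T₃ (a p q : A) : (G.Δ a).left (G.T₃ (p ⊗ₜ q)) = G.T₃ ((a * p) ⊗ₜ q) := by
  rw [← sub_eq_zero]
  apply G.tensor_eq_zero_left
  intro x y
  rw [sub_mul, ← G.left_mul, G.T₃_mul, G.T₃_mul, map_mul, sub_eq_zero]
  rfl

/-- `T₂(d ⊗ a)(c ⊗ 1) = (d ⊗ 1)T₃(a ⊗ c)`. -/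
theorem T₂_T₃ (d a c : A) : (LinearMap.mulRight ℂ c).rTensor A (G.T₂ (d ⊗ₜ a)) =
    (LinearMap.mulLeft ℂ d).rTensor A (G.T₃ (a ⊗ₜ c)) := by
  have hm : ∀ x y, x * (G.Δ a).left y = (G.Δ a).right x * y := (G.Δ a).2
  rw [← sub_eq_zero]
  apply G.tensor_eq_zero_left
  intro x y
  apply G.tensor_eq_zero_right
  intro u v
  have h1 : (u ⊗ₜ v) * ((LinearMap.mulRight ℂ c).rTensor A (G.T₂ (d ⊗ₜ a)) * (x ⊗ₜ y)) =
      (u ⊗ₜ v) * G.T₂ (d ⊗ₜ a) * ((c * x) ⊗ₜ y) := by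
    rw [mul_assoc]
    congr 1
    generalize G.T₂ (d ⊗ₜ a) = t
    induction t with
    | zero => simp
    | add s t hs ht => simp only [map_add, add_mul, hs, ht]
    | tmul u v => simp [mul_assoc]
  have h2 : (u ⊗ₜ v) * ((LinearMap.mulLeft ℂ d).rTensor A (G.T₃ (a ⊗ₜ c)) * (x ⊗ₜ y)) =
      ((u * d) ⊗ₜ v) * (G.T₃ (a ⊗ₜ c) * (x ⊗ₜ y)) := by
    rw [← mul_assoc, ← mul_assoc]
    congr 1
    generalize G.T₃ (a ⊗ₜ c) = t
    induction t with
    | zero => simp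
    | add s t hs ht => simp only [map_add, mul_add, hs, ht]
    | tmul u v => simp [mul_assoc]
  rw [sub_mul, mul_sub, h1, h2, G.T₃_mul, G.mul_T₂, hm]
  simp

/-- Coassociativity in the form
`(Δ ⊗ ι)(Δ(a)(1 ⊗ e))(c ⊗ 1 ⊗ 1) = (ι ⊗ Δ)(Δ(a)(c ⊗ 1))(1 ⊗ 1 ⊗ e)`. -/
theorem coassoc' (a c e : A) :
    TensorProduct.assoc ℂ A A A
      ((G.T₃.toLinearMap ∘ₗ (TensorProduct.mk ℂ A A).flip c).rTensor A (G.T₁ (a ⊗ₜ e))) =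
    (G.T₁.toLinearMap ∘ₗ (TensorProduct.mk ℂ A A).flip e).lTensor A (G.T₃ (a ⊗ₜ c)) := by
  rw [← sub_eq_zero]
  refine eq_zero_of_rTensor (fun d : A => LinearMap.mulLeft ℂ d)
    (fun x hx => G.eq_zero_of_mul_right x hx) _ fun d => ?_
  rw [map_sub, sub_eq_zero]
  have h := congrArg ((LinearMap.mulRight ℂ c).rTensor (A ⊗[ℂ] A)) (G.coassoc d a e)
  have hl : ∀ t : A ⊗[ℂ] A, (LinearMap.mulRight ℂ c).rTensor (A ⊗[ℂ] A)
      (TensorProduct.assoc ℂ A A A (G.T₂.toLinearMap.rTensor A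
        ((TensorProduct.assoc ℂ A A A).symm (d ⊗ₜ t)))) =
      (LinearMap.mulLeft ℂ d).rTensor (A ⊗[ℂ] A) (TensorProduct.assoc ℂ A A A
        ((G.T₃.toLinearMap ∘ₗ (TensorProduct.mk ℂ A A).flip c).rTensor A t)) := by
    have key : ∀ (g : A →ₗ[ℂ] A) (s : A ⊗[ℂ] A) (v : A), g.rTensor (A ⊗[ℂ] A)
        (TensorProduct.assoc ℂ A A A (s ⊗ₜ v)) =
        TensorProduct.assoc ℂ A A A (g.rTensor A s ⊗ₜ v) := by
      intro g s v
      induction s with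
      | zero => simp
      | add s t hs ht => simp only [TensorProduct.add_tmul, map_add, hs, ht]
      | tmul x y => simp
    intro t
    induction t with
    | zero => simp
    | add s t hs ht => simp only [TensorProduct.tmul_add, map_add, hs, ht]
    | tmul u v => simp [key, G.T₂_T₃]
  have hr : ∀ t : A ⊗[ℂ] A, (LinearMap.mulRight ℂ c).rTensor (A ⊗[ℂ] A)
      (G.T₁.toLinearMap.lTensor A (TensorProduct.assoc ℂ A A A (t ⊗ₜ e))) =
      (G.T₁.toLinearMap ∘ₗ (TensorProduct.mk ℂ A A).flip e).lTensor A
        ((LinearMap.mulRight ℂ c).rTensor A t) := by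
    intro t
    induction t with
    | zero => simp
    | add s t hs ht => simp only [TensorProduct.add_tmul, map_add, hs, ht]
    | tmul u v => simp
  have hr' : ∀ t : A ⊗[ℂ] A, (LinearMap.mulLeft ℂ d).rTensor (A ⊗[ℂ] A)
      ((G.T₁.toLinearMap ∘ₗ (TensorProduct.mk ℂ A A).flip e).lTensor A t) =
      (G.T₁.toLinearMap ∘ₗ (TensorProduct.mk ℂ A A).flip e).lTensor A
        ((LinearMap.mulLeft ℂ d).rTensor A t) := by
    intro t
    induction t with
    | zero => simp
    | add s t hs ht => simp only [map_add, hs, ht]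
    | tmul u v => simp
  rw [hl, hr, G.T₂_T₃] at h
  rw [h, hr']

end RegularMultiplierHopfAlgebra

/-! ### The dual algebra -/

namespace AlgebraicQuantumGroup

open TensorProduct (dualDistrib)

variable {A : Type*} [NonUnitalRing A] [Module ℂ A] [IsScalarTower ℂ A A] [SMulCommClass ℂ A A]
  (G : AlgebraicQuantumGroup A)

/-- The functional `φ( · c)`, as a linear map in `c`. -/
def fourier : A →ₗ[ℂ] Module.Dual ℂ A := LinearMap.compr₂ (LinearMap.mul ℂ A).flip G.φ

@[simp] theorem fourier_apply (c a : A) : G.fourier c a = G.φ (a * c) := rfl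

/-- The dual `B` of `A`: the space of linear functionals on `A` of the form `φ( · c)`. -/
def Dual : Type _ := LinearMap.range G.fourier

instance : AddCommGroup G.Dual := inferInstanceAs (AddCommGroup (LinearMap.range G.fourier))

instance : Module ℂ G.Dual := inferInstanceAs (Module ℂ (LinearMap.range G.fourier))

/-- The pairing `⟨a, b⟩ = b(a)`, as a pairing of `B` with `A`. -/
def ev : G.Dual →ₗ[ℂ] Module.Dual ℂ A := (LinearMap.range G.fourier).subtype

theorem ev_injective : Function.Injective G.ev := Subtype.val_injective

/-- The element `φ( · c)` of `B`. -/
def toDual : A →ₗ[ℂ] G.Dual := G.fourier.rangeRestrict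

@[simp] theorem ev_toDual (c a : A) : G.ev (G.toDual c) a = G.φ (a * c) := rfl

theorem toDual_surjective : Function.Surjective G.toDual := G.fourier.surjective_rangeRestrict

/-- An element `c` with `b = φ( · c)`. -/
def rep (b : G.Dual) : A := (G.toDual_surjective b).choose

@[simp] theorem toDual_rep (b : G.Dual) : G.toDual (G.rep b) = b :=
  (G.toDual_surjective b).choose_spec

/-- For `b = φ( · c)` and `b' = φ( · c')`, the functional
`a ↦ ⟨Δ(a), b ⊗ b'⟩ = (φ ⊗ φ)(Δ(a)(c ⊗ c'))`. -/
def convolution (c c' : A) : Module.Dual ℂ A where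
  toFun a := dualDistrib ℂ A A (G.φ ⊗ₜ G.φ) ((G.Δ a).left (c ⊗ₜ c'))
  map_add' a a' := by
    rw [map_add]
    exact map_add (dualDistrib ℂ A A (G.φ ⊗ₜ G.φ)) _ _
  map_smul' r a := by
    rw [map_smul]
    exact map_smul (dualDistrib ℂ A A (G.φ ⊗ₜ G.φ)) r _

theorem convolution_eq (c c' a : A) : G.convolution c c' a =
    dualDistrib ℂ A A (G.ev (G.toDual c) ⊗ₜ G.φ) (G.T₁ (a ⊗ₜ c')) := by
  change dualDistrib ℂ A A (G.φ ⊗ₜ G.φ) ((G.Δ a).left (c ⊗ₜ c')) = _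
  rw [G.Δ_left_tmul]
  generalize G.T₁ (a ⊗ₜ c') = t
  induction t with
  | zero => simp
  | add s t hs ht => simp only [map_add, hs, ht]
  | tmul x y => simp

theorem convolution_eq' (c c' a : A) : G.convolution c c' a =
    dualDistrib ℂ A A (G.φ ⊗ₜ G.ev (G.toDual c')) (G.T₃ (a ⊗ₜ c)) := by
  change dualDistrib ℂ A A (G.φ ⊗ₜ G.φ) ((G.Δ a).left (c ⊗ₜ c')) = _
  rw [G.Δ_left_tmul']
  generalize G.T₃ (a ⊗ₜ c) = t
  induction t with
  | zero => simp
  | add s t hs ht => simp only [map_add, hs, ht]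
  | tmul x y => simp

theorem convolution_mem (c c' : A) : G.convolution c c' ∈ LinearMap.range G.fourier := by
  have key : ∀ t : A ⊗[ℂ] A, ∃ x : A, ∀ a : A,
      dualDistrib ℂ A A (G.φ ⊗ₜ G.φ) ((G.Δ a).left (G.T₃ t)) = G.φ (a * x) := by
    intro t
    induction t with
    | zero => exact ⟨0, by simp⟩
    | add s t hs ht =>
      obtain ⟨x, hx⟩ := hs
      obtain ⟨y, hy⟩ := ht
      exact ⟨x + y, fun a => by simp only [map_add, mul_add, hx, hy]⟩
    | tmul p q =>
      refine ⟨G.φ q • p, fun a => ?_⟩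
      have h : ∀ t : A ⊗[ℂ] A, dualDistrib ℂ A A (G.φ ⊗ₜ G.φ) t = G.φ (sliceRight G.φ t) := by
        intro t
        induction t with
        | zero => simp
        | add s t hs ht => simp only [map_add, hs, ht]
        | tmul x y => simp [mul_comm]
      rw [G.Δ_left_T₃, h, G.left_invariant, map_smul, mul_smul_comm, map_smul]
      simp [mul_comm]
  obtain ⟨x, hx⟩ := key (G.T₃.symm (c ⊗ₜ c'))
  refine ⟨x, ?_⟩
  ext a
  rw [fourier_apply, ← hx a, LinearEquiv.apply_symm_apply]
  rfl

/-- The product of `B`, given by `⟨a, bb'⟩ = ⟨Δ(a), b ⊗ b'⟩`. -/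
instance : Mul G.Dual := ⟨fun b b' => ⟨G.convolution (G.rep b) (G.rep b'), G.convolution_mem _ _⟩⟩

/-- The product does not depend on the choice of representatives. -/
theorem ev_mul (b : G.Dual) (c' a : A) : G.ev (b * G.toDual c') a =
    dualDistrib ℂ A A (G.ev b ⊗ₜ G.φ) (G.T₁ (a ⊗ₜ c')) := by
  change G.convolution (G.rep b) (G.rep (G.toDual c')) a = _
  rw [convolution_eq', toDual_rep, ← convolution_eq', convolution_eq, toDual_rep]

theorem ev_mul' (c : A) (b' : G.Dual) (a : A) : G.ev (G.toDual c * b') a =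
    dualDistrib ℂ A A (G.φ ⊗ₜ G.ev b') (G.T₃ (a ⊗ₜ c)) := by
  change G.convolution (G.rep (G.toDual c)) (G.rep b') a = _
  rw [convolution_eq, toDual_rep, ← convolution_eq, convolution_eq', toDual_rep]

theorem ev_ext {b b' : G.Dual} (h : ∀ a, G.ev b a = G.ev b' a) : b = b' :=
  G.ev_injective (LinearMap.ext h)

protected theorem mul_add (x y z : G.Dual) : x * (y + z) = x * y + x * z := by
  obtain ⟨c, rfl⟩ := G.toDual_surjective x
  apply G.ev_ext
  intro a
  rw [ev_mul', map_add, map_add, LinearMap.add_apply, ev_mul', ev_mul', TensorProduct.tmul_add,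
    map_add, LinearMap.add_apply]

protected theorem add_mul (x y z : G.Dual) : (x + y) * z = x * z + y * z := by
  obtain ⟨c, rfl⟩ := G.toDual_surjective z
  apply G.ev_ext
  intro a
  rw [ev_mul, map_add, map_add, LinearMap.add_apply, ev_mul, ev_mul, TensorProduct.add_tmul,
    map_add, LinearMap.add_apply]

protected theorem mul_smul (r : ℂ) (x y : G.Dual) : x * (r • y) = r • (x * y) := by
  obtain ⟨c, rfl⟩ := G.toDual_surjective x
  apply G.ev_ext
  intro a
  rw [ev_mul', map_smul, map_smul, LinearMap.smul_apply, ev_mul', TensorProduct.tmul_smul,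
    map_smul, LinearMap.smul_apply]

protected theorem smul_mul (r : ℂ) (x y : G.Dual) : (r • x) * y = r • (x * y) := by
  obtain ⟨c, rfl⟩ := G.toDual_surjective y
  apply G.ev_ext
  intro a
  rw [ev_mul, map_smul, map_smul, LinearMap.smul_apply, ev_mul, ← TensorProduct.smul_tmul',
    map_smul, LinearMap.smul_apply]

protected theorem mul_assoc (x y z : G.Dual) : x * y * z = x * (y * z) := by
  obtain ⟨c, rfl⟩ := G.toDual_surjective x
  obtain ⟨e, rfl⟩ := G.toDual_surjective z
  apply G.ev_ext
  intro a
  rw [ev_mul, ev_mul']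
  have h := congrArg (dualDistrib ℂ A (A ⊗[ℂ] A)
    (G.φ ⊗ₜ dualDistrib ℂ A A (G.ev y ⊗ₜ G.φ))) (G.coassoc' a c e)
  have hl : ∀ t : A ⊗[ℂ] A, dualDistrib ℂ A (A ⊗[ℂ] A)
      (G.φ ⊗ₜ dualDistrib ℂ A A (G.ev y ⊗ₜ G.φ)) (TensorProduct.assoc ℂ A A A
        ((G.T₃.toLinearMap ∘ₗ (TensorProduct.mk ℂ A A).flip c).rTensor A t)) =
      dualDistrib ℂ A A (G.ev (G.toDual c * y) ⊗ₜ G.φ) t := by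
    have key : ∀ (s : A ⊗[ℂ] A) (v : A), dualDistrib ℂ A (A ⊗[ℂ] A)
        (G.φ ⊗ₜ dualDistrib ℂ A A (G.ev y ⊗ₜ G.φ)) (TensorProduct.assoc ℂ A A A (s ⊗ₜ v)) =
        dualDistrib ℂ A A (G.φ ⊗ₜ G.ev y) s * G.φ v := by
      intro s v
      induction s with
      | zero => simp
      | add s t hs ht => simp only [TensorProduct.add_tmul, map_add, hs, ht, add_mul]
      | tmul x y => simp [mul_assoc]
    intro t
    induction t with
    | zero => simp
    | add s t hs ht => simp only [map_add, hs, ht]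
    | tmul u v => simp [key, ev_mul']
  have hr : ∀ t : A ⊗[ℂ] A, dualDistrib ℂ A (A ⊗[ℂ] A)
      (G.φ ⊗ₜ dualDistrib ℂ A A (G.ev y ⊗ₜ G.φ))
        ((G.T₁.toLinearMap ∘ₗ (TensorProduct.mk ℂ A A).flip e).lTensor A t) =
      dualDistrib ℂ A A (G.φ ⊗ₜ G.ev (y * G.toDual e)) t := by
    intro t
    induction t with
    | zero => simp
    | add s t hs ht => simp only [map_add, hs, ht]
    | tmul u v => simp [ev_mul]
  rw [hl, hr] at h
  exact h

instance : NonUnitalRing G.Dual where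
  left_distrib := G.mul_add
  right_distrib := G.add_mul
  mul_assoc := G.mul_assoc
  zero_mul x := by simpa using G.smul_mul 0 0 x
  mul_zero x := by simpa using G.mul_smul 0 x 0

instance : IsScalarTower ℂ G.Dual G.Dual := ⟨fun r x y => G.smul_mul r x y⟩

instance : SMulCommClass ℂ G.Dual G.Dual := ⟨fun r x y => (G.mul_smul r x y).symm⟩

/-! ### The coproduct of the dual and the duality element -/

/-- `Δ'` is the coproduct of `B`: `⟨a ⊗ a', Δ'(b)⟩ = ⟨aa', b⟩`, where the pairing
of `B ⊗ B` with `A ⊗ A` is extended to `M(B ⊗ B)`. -/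
def IsDualCoproduct (Δ' : G.Dual →ₗ[ℂ] Multiplier (G.Dual ⊗[ℂ] G.Dual)) : Prop :=
  ∀ b : G.Dual, IsExtendedPairing (tensorPairing G.ev G.ev) (Δ' b) (G.ev b ∘ₗ LinearMap.mul' ℂ A)

/-- `V ∈ M(B ⊗ A)` is the duality: `⟨V, a ⊗ b⟩ = ⟨a, b⟩`, where the
pairing of `B ⊗ A` with `A ⊗ B` is extended to `M(B ⊗ A)`. -/
def IsDuality (V : Multiplier (G.Dual ⊗[ℂ] A)) : Prop :=
  IsExtendedPairing (tensorPairing G.ev G.ev.flip) V (TensorProduct.lift G.ev.flip)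

end AlgebraicQuantumGroup

/-! ### Application of an antipode to one leg of a multiplier -/

section Legs

variable {X Y : Type*} [NonUnitalRing X] [Module ℂ X] [IsScalarTower ℂ X X] [SMulCommClass ℂ X X]
  [NonUnitalRing Y] [Module ℂ Y] [IsScalarTower ℂ Y Y] [SMulCommClass ℂ Y Y]

open Multiplier

/-- `W = (S ⊗ ι)V` in `M(X ⊗ Y)`, for an anti-homomorphism `S` of `X`: for all `x, y`, the
multipliers `(x ⊗ 1)V(1 ⊗ y)` and `(1 ⊗ y)V(x ⊗ 1)` lie in `X ⊗ Y`, and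
`W(S(x) ⊗ y) = (S ⊗ ι)((x ⊗ 1)V(1 ⊗ y))` and
`(S(x) ⊗ y)W = (S ⊗ ι)((1 ⊗ y)V(x ⊗ 1))`. -/
def IsAntiLeft (S : X →ₗ[ℂ] X) (V W : Multiplier (X ⊗[ℂ] Y)) : Prop :=
  ∀ (x : X) (y : Y),
    (∃ t : X ⊗[ℂ] Y, of t = tmul (of x) 1 * V * tmul 1 (of y) ∧
      W.left (S x ⊗ₜ y) = S.rTensor Y t) ∧
    (∃ t : X ⊗[ℂ] Y, of t = tmul 1 (of y) * V * tmul (of x) 1 ∧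
      W.right (S x ⊗ₜ y) = S.rTensor Y t)

/-- `W = (ι ⊗ S)V` in `M(X ⊗ Y)`, for an anti-homomorphism `S` of `Y`: for all `x, y`, the
multipliers `(1 ⊗ y)V(x ⊗ 1)` and `(x ⊗ 1)V(1 ⊗ y)` lie in `X ⊗ Y`, and
`W(x ⊗ S(y)) = (ι ⊗ S)((1 ⊗ y)V(x ⊗ 1))` and
`(x ⊗ S(y))W = (ι ⊗ S)((x ⊗ 1)V(1 ⊗ y))`. -/
def IsAntiRight (S : Y →ₗ[ℂ] Y) (V W : Multiplier (X ⊗[ℂ] Y)) : Prop :=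
  ∀ (x : X) (y : Y),
    (∃ t : X ⊗[ℂ] Y, of t = tmul 1 (of y) * V * tmul (of x) 1 ∧
      W.left (x ⊗ₜ S y) = S.lTensor X t) ∧
    (∃ t : X ⊗[ℂ] Y, of t = tmul (of x) 1 * V * tmul 1 (of y) ∧
      W.right (x ⊗ₜ S y) = S.lTensor X t)

end Legs

/-- `x` is the unique object with the property `P`. -/
def IsThe {α : Type*} (P : α → Prop) (x : α) : Prop := P x ∧ ∀ y, P y → y = x

end AQG

end

/-!
Pairing the first leg of `V(b ⊗ a)` with `x ∈ A` gives `(b ▷ x)a`, where `⟨b', b ▷ x⟩ = ⟨b'b, x⟩`.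
Writing `b = φ( · c)`, this is `(ι ⊗ φ)(Δ(x)(a ⊗ c)) = (ι ⊗ φ)(Δ(x)(1 ⊗ c))a`: on the left, `V`
acts through the bijection `c ↦ φ( · c)` as the inverse of `T₃`. In the same way `V` acts on the
right through `d ↦ ψ(d · )`, with `ψ = φ ∘ S`, as the inverse of `T₄`. So `V` is invertible, and
slicing `V⁻¹(b ⊗ a)` with `x` gives `S(b ▷ x)a`. Since `S` intertwines the left and the right
action of `B` on `A`, both `(S ⊗ ι)V` and `(ι ⊗ S)V` are this inverse.
-/

noncomputable section

namespace AQG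

/-! ### Slice maps -/

section SliceCalculus

variable {X Y X' Y' : Type*} [AddCommGroup X] [Module ℂ X] [AddCommGroup Y] [Module ℂ Y]
  [AddCommGroup X'] [Module ℂ X'] [AddCommGroup Y'] [Module ℂ Y']

theorem sliceRight_lTensor (f : Module.Dual ℂ Y') (g : Y →ₗ[ℂ] Y') (t : X ⊗[ℂ] Y) :
    sliceRight f (g.lTensor X t) = sliceRight (f ∘ₗ g) t := by
  induction t <;> simp_all

theorem sliceRight_rTensor (f : Module.Dual ℂ Y) (g : X →ₗ[ℂ] X') (t : X ⊗[ℂ] Y) :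
    sliceRight f (g.rTensor Y t) = g (sliceRight f t) := by
  induction t <;> simp_all

theorem sliceLeft_rTensor (f : Module.Dual ℂ X') (g : X →ₗ[ℂ] X') (t : X ⊗[ℂ] Y) :
    sliceLeft f (g.rTensor Y t) = sliceLeft (f ∘ₗ g) t := by
  induction t <;> simp_all

theorem sliceLeft_lTensor (f : Module.Dual ℂ X) (g : Y →ₗ[ℂ] Y') (t : X ⊗[ℂ] Y) :
    sliceLeft f (g.lTensor X t) = g (sliceLeft f t) := by
  induction t <;> simp_all

theorem sliceLeft_map (f : Module.Dual ℂ X') (g : X →ₗ[ℂ] X') (h : Y →ₗ[ℂ] Y') (t : X ⊗[ℂ] Y) :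
    sliceLeft f (TensorProduct.map g h t) = h (sliceLeft (f ∘ₗ g) t) := by
  induction t <;> simp_all

theorem sliceRight_map (f : Module.Dual ℂ Y') (g : X →ₗ[ℂ] X') (h : Y →ₗ[ℂ] Y') (t : X ⊗[ℂ] Y) :
    sliceRight f (TensorProduct.map g h t) = g (sliceRight (f ∘ₗ h) t) := by
  induction t <;> simp_all

theorem lTensor_rTensor (f : X →ₗ[ℂ] X') (g : Y →ₗ[ℂ] Y') (t : X ⊗[ℂ] Y) :
    g.lTensor X' (f.rTensor Y t) = f.rTensor Y' (g.lTensor X t) := by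
  induction t <;> simp_all

@[simp] theorem sliceRight_comm (f : Module.Dual ℂ X) (t : X ⊗[ℂ] Y) :
    sliceRight f (TensorProduct.comm ℂ X Y t) = sliceLeft f t := by
  induction t <;> simp_all

@[simp] theorem sliceLeft_comm (f : Module.Dual ℂ Y) (t : X ⊗[ℂ] Y) :
    sliceLeft f (TensorProduct.comm ℂ X Y t) = sliceRight f t := by
  induction t <;> simp_all

theorem sliceLeft_assoc_tmul (f : Module.Dual ℂ X) (t : X ⊗[ℂ] Y) (z : X') :
    sliceLeft f (TensorProduct.assoc ℂ X Y X' (t ⊗ₜ z)) = sliceLeft f t ⊗ₜ z := by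
  induction t <;> simp_all [TensorProduct.add_tmul, TensorProduct.smul_tmul']

theorem apply_sliceRight (g : Module.Dual ℂ X) (f : Module.Dual ℂ Y) (t : X ⊗[ℂ] Y) :
    g (sliceRight f t) = f (sliceLeft g t) := by
  induction t <;> simp_all [mul_comm]

theorem dualDistrib_apply (f : Module.Dual ℂ X) (g : Module.Dual ℂ Y) (t : X ⊗[ℂ] Y) :
    TensorProduct.dualDistrib ℂ X Y (f ⊗ₜ g) t = f (sliceRight g t) := by
  induction t <;> simp_all [mul_comm]

theorem ext_sliceRight {t t' : X ⊗[ℂ] Y}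
    (h : ∀ f : Module.Dual ℂ Y, sliceRight f t = sliceRight f t') : t = t' :=
  sub_eq_zero.1 (eq_zero_of_sliceRight _ fun f => by rw [map_sub, h, sub_self])

theorem ext_sliceLeft {t t' : X ⊗[ℂ] Y}
    (h : ∀ f : Module.Dual ℂ X, sliceLeft f t = sliceLeft f t') : t = t' :=
  sub_eq_zero.1 (eq_zero_of_sliceLeft _ fun f => by rw [map_sub, h, sub_self])

theorem exists_apply_eq_one {φ : Module.Dual ℂ X} (hφ₀ : φ ≠ 0) : ∃ w, φ w = 1 :=
  LinearMap.surjective hφ₀ 1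

end SliceCalculus

/-! ### Canonical maps of a regular multiplier Hopf algebra -/

/-- A non-degenerate product on `A`, with the canonical maps
`T₁ (a ⊗ b) = Δ(a)(1 ⊗ b)`, `T₂ (a ⊗ b) = (a ⊗ 1)Δ(b)`, `T₃ (a ⊗ b) = Δ(a)(b ⊗ 1)`,
`T₄ (a ⊗ b) = (1 ⊗ a)Δ(b)` of a coassociative coproduct, and the maps `left a : x ↦ Δ(a)x` and
`right a : x ↦ xΔ(a)` of `A ⊗ A`. The product is a field, rather than an instance, so that the
opposite structures live on the same vector space. -/
structure CanonicalMaps (A : Type*) [AddCommGroup A] [Module ℂ A] where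
  mul : A →ₗ[ℂ] A →ₗ[ℂ] A
  assoc : ∀ a b c, mul (mul a b) c = mul a (mul b c)
  eq_zero_left : ∀ a, (∀ b, mul a b = 0) → a = 0
  eq_zero_right : ∀ a, (∀ b, mul b a = 0) → a = 0
  T₁ : (A ⊗[ℂ] A) ≃ₗ[ℂ] (A ⊗[ℂ] A)
  T₂ : (A ⊗[ℂ] A) ≃ₗ[ℂ] (A ⊗[ℂ] A)
  T₃ : (A ⊗[ℂ] A) ≃ₗ[ℂ] (A ⊗[ℂ] A)
  T₄ : (A ⊗[ℂ] A) ≃ₗ[ℂ] (A ⊗[ℂ] A)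
  left : A → (A ⊗[ℂ] A) →ₗ[ℂ] (A ⊗[ℂ] A)
  right : A → (A ⊗[ℂ] A) →ₗ[ℂ] (A ⊗[ℂ] A)
  T₂_T₁ : ∀ d a c, (mul.flip c).lTensor A (T₂ (d ⊗ₜ a)) = (mul d).rTensor A (T₁ (a ⊗ₜ c))
  T₂_T₃ : ∀ d a c, (mul.flip c).rTensor A (T₂ (d ⊗ₜ a)) = (mul d).rTensor A (T₃ (a ⊗ₜ c))
  T₄_T₁ : ∀ d a c, (mul.flip c).lTensor A (T₄ (d ⊗ₜ a)) = (mul d).lTensor A (T₁ (a ⊗ₜ c))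
  T₄_T₃ : ∀ d a c, (mul.flip c).rTensor A (T₄ (d ⊗ₜ a)) = (mul d).lTensor A (T₃ (a ⊗ₜ c))
  left_tmul₁ : ∀ a u v, left a (u ⊗ₜ v) = (mul.flip u).rTensor A (T₁ (a ⊗ₜ v))
  left_tmul₃ : ∀ a u v, left a (u ⊗ₜ v) = (mul.flip v).lTensor A (T₃ (a ⊗ₜ u))
  right_tmul₂ : ∀ a u v, right a (u ⊗ₜ v) = (mul v).lTensor A (T₂ (u ⊗ₜ a))
  right_tmul₄ : ∀ a u v, right a (u ⊗ₜ v) = (mul u).rTensor A (T₄ (v ⊗ₜ a))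
  left_T₁ : ∀ a b c, left a (T₁ (b ⊗ₜ c)) = T₁ (mul a b ⊗ₜ c)
  left_T₃ : ∀ a b c, left a (T₃ (b ⊗ₜ c)) = T₃ (mul a b ⊗ₜ c)
  right_T₂ : ∀ a b c, right a (T₂ (c ⊗ₜ b)) = T₂ (c ⊗ₜ mul b a)
  right_T₄ : ∀ a b c, right a (T₄ (c ⊗ₜ b)) = T₄ (c ⊗ₜ mul b a)
  coassoc₁₂ : ∀ (f g : Module.Dual ℂ A) (a c d : A),
    sliceLeft g (T₂ (d ⊗ₜ sliceRight f (T₁ (a ⊗ₜ c)))) =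
      sliceRight f (T₁ (sliceLeft g (T₂ (d ⊗ₜ a)) ⊗ₜ c))
  coassoc₃₄ : ∀ (f g : Module.Dual ℂ A) (a c d : A),
    sliceLeft g (T₃ (sliceRight f (T₄ (c ⊗ₜ a)) ⊗ₜ d)) =
      sliceRight f (T₄ (c ⊗ₜ sliceLeft g (T₃ (a ⊗ₜ d))))

namespace CanonicalMaps

variable {A : Type*} [AddCommGroup A] [Module ℂ A] (K : CanonicalMaps A)

/-- The canonical maps of the opposite algebra. -/
def op : CanonicalMaps A where
  mul := K.mul.flip
  assoc a b c := (K.assoc c b a).symm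
  eq_zero_left := K.eq_zero_right
  eq_zero_right := K.eq_zero_left
  T₁ := TensorProduct.comm ℂ A A ≪≫ₗ K.T₄
  T₂ := TensorProduct.comm ℂ A A ≪≫ₗ K.T₃
  T₃ := TensorProduct.comm ℂ A A ≪≫ₗ K.T₂
  T₄ := TensorProduct.comm ℂ A A ≪≫ₗ K.T₁
  left := K.right
  right := K.left
  T₂_T₁ d a c := (K.T₄_T₃ c a d).symm
  T₂_T₃ d a c := (K.T₂_T₃ c a d).symm
  T₄_T₁ d a c := (K.T₄_T₁ c a d).symm
  T₄_T₃ d a c := (K.T₂_T₁ c a d).symm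
  left_tmul₁ := K.right_tmul₄
  left_tmul₃ := K.right_tmul₂
  right_tmul₂ := K.left_tmul₃
  right_tmul₄ := K.left_tmul₁
  left_T₁ a b c := K.right_T₄ a b c
  left_T₃ a b c := K.right_T₂ a b c
  right_T₂ a b c := K.left_T₃ a b c
  right_T₄ a b c := K.left_T₁ a b c
  coassoc₁₂ := K.coassoc₃₄
  coassoc₃₄ := K.coassoc₁₂

/-- The canonical maps of the opposite algebra with the opposite coproduct. -/
def opCop : CanonicalMaps A where
  mul := K.mul.flip
  assoc a b c := (K.assoc c b a).symm
  eq_zero_left := K.eq_zero_right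
  eq_zero_right := K.eq_zero_left
  T₁ := TensorProduct.comm ℂ A A ≪≫ₗ K.T₂ ≪≫ₗ TensorProduct.comm ℂ A A
  T₂ := TensorProduct.comm ℂ A A ≪≫ₗ K.T₁ ≪≫ₗ TensorProduct.comm ℂ A A
  T₃ := TensorProduct.comm ℂ A A ≪≫ₗ K.T₄ ≪≫ₗ TensorProduct.comm ℂ A A
  T₄ := TensorProduct.comm ℂ A A ≪≫ₗ K.T₃ ≪≫ₗ TensorProduct.comm ℂ A A
  left a := (TensorProduct.comm ℂ A A).toLinearMap ∘ₗ K.right a ∘ₗ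
    (TensorProduct.comm ℂ A A).toLinearMap
  right a := (TensorProduct.comm ℂ A A).toLinearMap ∘ₗ K.left a ∘ₗ
    (TensorProduct.comm ℂ A A).toLinearMap
  T₂_T₁ d a c := by simp [LinearMap.lTensor_comm, LinearMap.rTensor_comm, ← K.T₂_T₁]
  T₂_T₃ d a c := by simp [LinearMap.rTensor_comm, ← K.T₄_T₁]
  T₄_T₁ d a c := by simp [LinearMap.lTensor_comm, ← K.T₂_T₃]
  T₄_T₃ d a c := by simp [LinearMap.lTensor_comm, LinearMap.rTensor_comm, ← K.T₄_T₃]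
  left_tmul₁ a u v := by simp [LinearMap.rTensor_comm, K.right_tmul₂]
  left_tmul₃ a u v := by simp [LinearMap.lTensor_comm, K.right_tmul₄]
  right_tmul₂ a u v := by simp [LinearMap.lTensor_comm, K.left_tmul₁]
  right_tmul₄ a u v := by simp [LinearMap.rTensor_comm, K.left_tmul₃]
  left_T₁ a b c := by simp [K.right_T₂]
  left_T₃ a b c := by simp [K.right_T₄]
  right_T₂ a b c := by simp [K.left_T₁]
  right_T₄ a b c := by simp [K.left_T₃]
  coassoc₁₂ f g a c d := by simp [K.coassoc₁₂]
  coassoc₃₄ f g a c d := by simp [K.coassoc₃₄]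

/-- The product as a map on the tensor product. -/
def mul' : A ⊗[ℂ] A →ₗ[ℂ] A := TensorProduct.lift K.mul

@[simp] theorem mul'_tmul (a b : A) : K.mul' (a ⊗ₜ b) = K.mul a b := TensorProduct.lift.tmul a b

theorem op_mul' (t : A ⊗[ℂ] A) : K.op.mul' t = K.mul' (TensorProduct.comm ℂ A A t) := by
  induction t <;> simp_all [op]

theorem opCop_mul' (t : A ⊗[ℂ] A) : K.opCop.mul' t = K.mul' (TensorProduct.comm ℂ A A t) :=
  K.op_mul' t

theorem mul'_rTensor_mul (a : A) (t : A ⊗[ℂ] A) :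
    K.mul' ((K.mul a).rTensor A t) = K.mul a (K.mul' t) := by
  induction t <;> simp_all [K.assoc]

theorem mul'_lTensor_flip_mul (a : A) (t : A ⊗[ℂ] A) :
    K.mul' ((K.mul.flip a).lTensor A t) = K.mul (K.mul' t) a := by
  induction t <;> simp_all [K.assoc]

theorem eq_of_mul_left {a b : A} (h : ∀ c, K.mul c a = K.mul c b) : a = b :=
  sub_eq_zero.1 (K.eq_zero_right _ fun c => by rw [map_sub, h, sub_self])

theorem eq_of_mul_right {a b : A} (h : ∀ c, K.mul a c = K.mul b c) : a = b :=
  K.op.eq_of_mul_left h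

theorem eq_of_lTensor_flip_mul {t t' : A ⊗[ℂ] A}
    (h : ∀ c, (K.mul.flip c).lTensor A t = (K.mul.flip c).lTensor A t') : t = t' :=
  sub_eq_zero.1 (eq_zero_of_lTensor (fun c => K.mul.flip c) K.eq_zero_left _
    fun c => by rw [map_sub, h, sub_self])

theorem eq_of_rTensor_mul {t t' : A ⊗[ℂ] A}
    (h : ∀ c, (K.mul c).rTensor A t = (K.mul c).rTensor A t') : t = t' :=
  sub_eq_zero.1 (eq_zero_of_rTensor (fun c => K.mul c) K.eq_zero_right _
    fun c => by rw [map_sub, h, sub_self])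

theorem eq_of_sliceLeft_comp_mul {t t' : A ⊗[ℂ] A}
    (h : ∀ (g : Module.Dual ℂ A) d, sliceLeft (g ∘ₗ K.mul d) t = sliceLeft (g ∘ₗ K.mul d) t') :
    t = t' :=
  K.eq_of_rTensor_mul fun d => ext_sliceLeft fun g => by
    rw [sliceLeft_rTensor, h, sliceLeft_rTensor]

/-- `(g(d · ) ⊗ ι)Δ(a)`, as a linear map in `a`. -/
def sliceLeftT₂ (g : Module.Dual ℂ A) (d : A) : A →ₗ[ℂ] A :=
  sliceLeft g ∘ₗ K.T₂.toLinearMap ∘ₗ TensorProduct.mk ℂ A A d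

@[simp] theorem sliceLeftT₂_apply (g : Module.Dual ℂ A) (d a : A) :
    K.sliceLeftT₂ g d a = sliceLeft g (K.T₂ (d ⊗ₜ a)) := rfl

/-- `(ι ⊗ f( · c))Δ(a)`, as a linear map in `c`. -/
def sliceRightT₁ (f : Module.Dual ℂ A) (a : A) : A →ₗ[ℂ] A :=
  sliceRight f ∘ₗ K.T₁.toLinearMap ∘ₗ TensorProduct.mk ℂ A A a

@[simp] theorem sliceRightT₁_apply (f : Module.Dual ℂ A) (a c : A) :
    K.sliceRightT₁ f a c = sliceRight f (K.T₁ (a ⊗ₜ c)) := rfl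

theorem sliceLeft_comp_mul_T₁ (g : Module.Dual ℂ A) (d : A) (t : A ⊗[ℂ] A) :
    sliceLeft (g ∘ₗ K.mul d) (K.T₁ t) = K.mul' ((K.sliceLeftT₂ g d).rTensor A t) := by
  induction t with
  | zero => simp
  | add s t hs ht => simp only [map_add, hs, ht]
  | tmul a c => rw [← sliceLeft_rTensor, ← K.T₂_T₁, sliceLeft_lTensor]; simp

theorem apply_mul_sliceRight_T₁ (f g : Module.Dual ℂ A) (d a c : A) :
    f (K.mul d (sliceRight g (K.T₁ (a ⊗ₜ c)))) = g (K.mul (sliceLeft f (K.T₂ (d ⊗ₜ a))) c) := by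
  rw [← sliceRight_rTensor, ← K.T₂_T₁, sliceRight_lTensor, apply_sliceRight]
  rfl

theorem apply_mul_sliceRight_T₄ (f g : Module.Dual ℂ A) (d a c : A) :
    f (K.mul (sliceRight g (K.T₄ (c ⊗ₜ a))) d) = g (K.mul c (sliceLeft f (K.T₃ (a ⊗ₜ d)))) :=
  K.op.apply_mul_sliceRight_T₁ f g d a c

theorem rTensor_sliceLeftT₂_T₁ (g : Module.Dual ℂ A) (d : A) (t : A ⊗[ℂ] A) :
    (K.sliceLeftT₂ g d).rTensor A (K.T₁ t) = K.T₁ ((K.sliceLeftT₂ g d).rTensor A t) := by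
  induction t with
  | zero => simp
  | add s t hs ht => simp only [map_add, hs, ht]
  | tmul a c => exact ext_sliceRight fun f => by rw [sliceRight_rTensor]; simp [K.coassoc₁₂]

theorem T₁_symm_sliceLeftT₂_tmul (g : Module.Dual ℂ A) (d x y : A) :
    K.T₁.symm (K.sliceLeftT₂ g d x ⊗ₜ y) =
      (K.sliceLeftT₂ g d).rTensor A (K.T₁.symm (x ⊗ₜ y)) := by
  rw [LinearEquiv.symm_apply_eq, ← rTensor_sliceLeftT₂_T₁, LinearEquiv.apply_symm_apply,
    LinearMap.rTensor_tmul]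

/-! ### The counit -/

/-- `ε` is the counit: `(ε ⊗ ι)Δ(a) = a = (ι ⊗ ε)Δ(a)`, after multiplication with an element of
the other leg. -/
structure IsCounit (ε : Module.Dual ℂ A) : Prop where
  T₁ : ∀ t, sliceLeft ε (K.T₁ t) = K.mul' t
  T₂ : ∀ t, sliceRight ε (K.T₂ t) = K.mul' t

theorem mul'_T₁_symm_sliceLeft_T₂ (g : Module.Dual ℂ A) (t : A ⊗[ℂ] A) (y : A) :
    K.mul' (K.T₁.symm (sliceLeft g (K.T₂ t) ⊗ₜ y)) = g (K.mul' t) • y := by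
  induction t with
  | zero => simp
  | add s t hs ht => simp only [map_add, hs, ht, TensorProduct.add_tmul, add_smul]
  | tmul d x =>
    rw [← sliceLeftT₂_apply, T₁_symm_sliceLeftT₂_tmul, ← sliceLeft_comp_mul_T₁]
    simp

theorem exists_mul'_T₁_symm_eq_smul [Nontrivial A] :
    ∃ ε : Module.Dual ℂ A, ∀ v y, K.mul' (K.T₁.symm (v ⊗ₜ y)) = ε v • y := by
  obtain ⟨u, hu⟩ := exists_ne (0 : A)
  obtain ⟨g, hgu⟩ : ∃ g : Module.Dual ℂ A, g u = 1 := Module.Projective.exists_dual_eq_one ℂ hu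
  refine ⟨g ∘ₗ K.mul' ∘ₗ K.T₂.symm.toLinearMap ∘ₗ TensorProduct.mk ℂ A A u, fun v y => ?_⟩
  simpa [hgu] using K.mul'_T₁_symm_sliceLeft_T₂ g (K.T₂.symm (u ⊗ₜ v)) y

theorem exists_isCounit : ∃ ε, K.IsCounit ε := by
  rcases subsingleton_or_nontrivial A with _ | _
  · exact ⟨0, fun _ => Subsingleton.elim _ _, fun _ => Subsingleton.elim _ _⟩
  obtain ⟨ε, hε⟩ := K.exists_mul'_T₁_symm_eq_smul
  obtain ⟨u, hu⟩ := exists_ne (0 : A)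
  refine ⟨ε, fun t => ?_, fun t => ?_⟩
  · have h : sliceLeft ε = K.mul' ∘ₗ K.T₁.symm.toLinearMap :=
      TensorProduct.ext' fun v y => by simp [hε]
    simp [h]
  · refine (Module.forall_dual_apply_eq_zero_iff ℂ _).1 (fun f => ?_) |> sub_eq_zero.1
    rw [map_sub, sub_eq_zero, apply_sliceRight]
    exact smul_left_injective ℂ hu ((hε _ u).symm.trans (K.mul'_T₁_symm_sliceLeft_T₂ f t u))

variable {K} {ε : Module.Dual ℂ A}

theorem IsCounit.T₃ (h : K.IsCounit ε) (t : A ⊗[ℂ] A) : sliceRight ε (K.T₃ t) = K.mul' t := by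
  induction t with
  | zero => simp
  | add s t hs ht => simp only [map_add, hs, ht]
  | tmul a c =>
    refine K.eq_of_mul_left fun d => ?_
    rw [← sliceRight_rTensor, ← K.T₂_T₃, sliceRight_rTensor, h.T₂]
    simp [K.assoc]

theorem IsCounit.T₄ (h : K.IsCounit ε) (t : A ⊗[ℂ] A) : sliceLeft ε (K.T₄ t) = K.mul' t := by
  induction t with
  | zero => simp
  | add s t hs ht => simp only [map_add, hs, ht]
  | tmul d a =>
    refine K.eq_of_mul_right fun c => ?_
    rw [← LinearMap.flip_apply, ← sliceLeft_lTensor, K.T₄_T₁, sliceLeft_lTensor, h.T₁]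
    simp [K.assoc]

theorem IsCounit.op (h : K.IsCounit ε) : K.op.IsCounit ε where
  T₁ t := (h.T₄ _).trans (K.op_mul' t).symm
  T₂ t := (h.T₃ _).trans (K.op_mul' t).symm

theorem IsCounit.opCop (h : K.IsCounit ε) : K.opCop.IsCounit ε where
  T₁ t := by rw [opCop_mul', ← h.T₂]; exact sliceLeft_comm _ _
  T₂ t := by rw [opCop_mul', ← h.T₁]; exact sliceRight_comm _ _

theorem sliceLeft_left_T₁ (hε : K.IsCounit ε) (a : A) (t : A ⊗[ℂ] A) :
    sliceLeft ε (K.left a (K.T₁ t)) = K.mul a (sliceLeft ε (K.T₁ t)) := by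
  induction t with
  | zero => simp
  | add s t hs ht => simp only [map_add, hs, ht]
  | tmul b c => rw [K.left_T₁, hε.T₁, hε.T₁]; simp [K.assoc]

theorem sliceLeft_rTensor_flip_mul_T₁ (hε : K.IsCounit ε) (p : A) (t : A ⊗[ℂ] A) :
    sliceLeft ε ((K.mul.flip p).rTensor A (K.T₁ t)) = ε p • sliceLeft ε (K.T₁ t) := by
  induction t with
  | zero => simp
  | add s t hs ht => simp only [map_add, hs, ht, smul_add]
  | tmul a q =>
    rw [← K.left_tmul₁, hε.T₁, ← K.T₁.apply_symm_apply (p ⊗ₜ q), sliceLeft_left_T₁ hε,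
      LinearEquiv.apply_symm_apply]
    simp

theorem IsCounit.map_mul (hε : K.IsCounit ε) (x p : A) : ε (K.mul x p) = ε x * ε p := by
  rcases subsingleton_or_nontrivial A with _ | _
  · simp [Subsingleton.elim x 0]
  obtain ⟨q, hq⟩ := exists_ne (0 : A)
  have h := sliceLeft_rTensor_flip_mul_T₁ hε p (K.T₁.symm (x ⊗ₜ q))
  rw [LinearEquiv.apply_symm_apply] at h
  simp only [LinearMap.rTensor_tmul, LinearMap.flip_apply, sliceLeft_tmul, smul_smul] at h
  rw [smul_left_injective ℂ hq h, mul_comm]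

/-! ### Integrals and the antipode -/

variable (K) in
/-- `S` is the antipode, with respect to the counit `ε`: `m(S ⊗ ι)Δ(a) = ε(a)1 = m(ι ⊗ S)Δ(a)`,
after multiplication with an element of the leg not touched by `S`. -/
structure IsAntipode (ε : Module.Dual ℂ A) (S : A →ₗ[ℂ] A) : Prop where
  counit : K.IsCounit ε
  T₁ : ∀ t, K.mul' (S.rTensor A (K.T₁ t)) = sliceLeft ε t
  T₂ : ∀ t, K.mul' (S.lTensor A (K.T₂ t)) = sliceRight ε t

variable (K) in
/-- `φ` is left invariant: `(ι ⊗ φ)Δ(a) = φ(a)1`. -/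
structure IsLeftInvariant (φ : Module.Dual ℂ A) : Prop where
  T₂ : ∀ a b, sliceRight φ (K.T₂ (b ⊗ₜ a)) = φ a • b
  T₃ : ∀ a b, sliceRight φ (K.T₃ (a ⊗ₜ b)) = φ a • b

variable (K) in
/-- `ψ` is right invariant: `(ψ ⊗ ι)Δ(a) = ψ(a)1`. -/
structure IsRightInvariant (ψ : Module.Dual ℂ A) : Prop where
  T₁ : ∀ a b, sliceLeft ψ (K.T₁ (a ⊗ₜ b)) = ψ a • b
  T₄ : ∀ a b, sliceLeft ψ (K.T₄ (b ⊗ₜ a)) = ψ a • b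

variable {S S' : A →ₗ[ℂ] A} {φ ψ : Module.Dual ℂ A}

theorem IsLeftInvariant.op (h : K.IsLeftInvariant φ) : K.op.IsLeftInvariant φ := ⟨h.T₃, h.T₂⟩

theorem IsRightInvariant.op (h : K.IsRightInvariant ψ) : K.op.IsRightInvariant ψ := ⟨h.T₄, h.T₁⟩

theorem IsRightInvariant.opCop (h : K.IsRightInvariant ψ) : K.opCop.IsLeftInvariant ψ where
  T₂ a b := (sliceRight_comm _ _).trans (h.T₁ a b)
  T₃ a b := (sliceRight_comm _ _).trans (h.T₄ a b)

theorem IsAntipode.opCop (h : K.IsAntipode ε S) : K.opCop.IsAntipode ε S where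
  counit := h.counit.opCop
  T₁ t := by
    rw [opCop_mul', ← LinearMap.lTensor_comm, ← sliceRight_comm, ← h.T₂]
    simp [CanonicalMaps.opCop]
  T₂ t := by
    rw [opCop_mul', ← LinearMap.rTensor_comm, ← sliceLeft_comm, ← h.T₁]
    simp [CanonicalMaps.opCop]

theorem mul'_rTensor_sliceLeftT₂_comm (g : Module.Dual ℂ A) (a d : A) (t : A ⊗[ℂ] A) :
    K.mul' ((K.sliceLeftT₂ g d).rTensor A
        (TensorProduct.comm ℂ A A ((K.sliceRightT₁ φ a).lTensor A t))) =
      sliceRight φ (K.left (K.sliceLeftT₂ g d a) t) := by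
  induction t with
  | zero => simp
  | add s t hs ht => simp only [map_add, hs, ht]
  | tmul u v => rw [K.left_tmul₁, sliceRight_rTensor]; simp [K.coassoc₁₂]

theorem T₁_comm_sliceRightT₁_T₃ (hφ : K.IsLeftInvariant φ) (a b z : A) :
    K.T₁ (TensorProduct.comm ℂ A A ((K.sliceRightT₁ φ a).lTensor A (K.T₃ (b ⊗ₜ z)))) =
      sliceRight φ (K.T₁ (a ⊗ₜ b)) ⊗ₜ z := by
  refine K.eq_of_sliceLeft_comp_mul fun g d => ?_
  rw [sliceLeft_comp_mul_T₁, mul'_rTensor_sliceLeftT₂_comm, K.left_T₃, hφ.T₃, sliceLeftT₂_apply,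
    ← apply_mul_sliceRight_T₁]
  rfl

theorem IsCounit.comp_sliceRightT₁ (hε : K.IsCounit ε) (a : A) :
    ε ∘ₗ K.sliceRightT₁ φ a = φ ∘ₗ K.mul a := by
  ext v
  rw [LinearMap.comp_apply, sliceRightT₁_apply, apply_sliceRight, hε.T₁]
  simp

theorem IsCounit.comp_sliceLeftT₂ (hε : K.IsCounit ε) (d : A) :
    ε ∘ₗ K.sliceLeftT₂ φ d = φ ∘ₗ K.mul d := by
  ext v
  rw [LinearMap.comp_apply, sliceLeftT₂_apply, ← apply_sliceRight, hε.T₂]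
  simp

theorem mul_sliceRight_T₄ (hε : K.IsCounit ε) (hφ : K.IsLeftInvariant φ) (t : A ⊗[ℂ] A) (z : A) :
    K.mul (sliceRight φ (K.T₄ t)) z =
      sliceLeft ε (K.T₁.symm (sliceRight φ (K.T₁ t) ⊗ₜ z)) := by
  induction t with
  | zero => simp
  | add s t hs ht => simp only [map_add, LinearMap.add_apply, TensorProduct.add_tmul, hs, ht]
  | tmul a b =>
    rw [← T₁_comm_sliceRightT₁_T₃ hφ, LinearEquiv.symm_apply_apply, sliceLeft_comm,
      sliceRight_lTensor, hε.comp_sliceRightT₁, ← sliceRight_lTensor, ← K.T₄_T₃,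
      sliceRight_rTensor]
    rfl

theorem IsAntipode.mul_apply (hS : K.IsAntipode ε S) (x z : A) :
    K.mul (S x) z = sliceLeft ε (K.T₁.symm (x ⊗ₜ z)) := by
  rw [← hS.T₁, LinearEquiv.apply_symm_apply]
  simp

theorem lTensor_T₂_of_mul_apply (hε : K.IsCounit ε)
    (hS : ∀ x z, K.mul (S x) z = sliceLeft ε (K.T₁.symm (x ⊗ₜ z))) (p q z : A) :
    (K.mul.flip z).lTensor A (S.lTensor A (K.T₂ (p ⊗ₜ q))) =
      (K.mul p).rTensor A (K.T₁.symm (q ⊗ₜ z)) := by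
  refine ext_sliceLeft fun f => ?_
  rw [sliceLeft_lTensor, sliceLeft_lTensor, sliceLeft_rTensor, ← hε.comp_sliceLeftT₂,
    ← sliceLeft_rTensor, ← T₁_symm_sliceLeftT₂_tmul, ← hS]
  rfl

theorem IsAntipode.of_mul_apply (hε : K.IsCounit ε)
    (hS : ∀ x z, K.mul (S x) z = sliceLeft ε (K.T₁.symm (x ⊗ₜ z))) : K.IsAntipode ε S where
  counit := hε
  T₁ t := by
    have h : K.mul' ∘ₗ S.rTensor A = sliceLeft ε ∘ₗ K.T₁.symm.toLinearMap :=
      TensorProduct.ext' fun x z => by simp [hS]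
    simpa using LinearMap.congr_fun h (K.T₁ t)
  T₂ t := by
    induction t with
    | zero => simp
    | add s t hs ht => simp only [map_add, hs, ht]
    | tmul p q =>
      refine K.eq_of_mul_right fun z => ?_
      rw [← mul'_lTensor_flip_mul, lTensor_T₂_of_mul_apply hε hS, mul'_rTensor_mul, ← hε.T₁,
        LinearEquiv.apply_symm_apply]
      simp

theorem exists_isAntipode (hε : K.IsCounit ε) (hφ : K.IsLeftInvariant φ) (hφ₀ : φ ≠ 0) :
    ∃ S, K.IsAntipode ε S := by
  obtain ⟨w, hw⟩ := exists_apply_eq_one hφ₀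
  refine ⟨sliceRight φ ∘ₗ K.T₄.toLinearMap ∘ₗ K.T₁.symm.toLinearMap ∘ₗ
    (TensorProduct.mk ℂ A A).flip w, .of_mul_apply hε fun x z => ?_⟩
  simpa [hw] using mul_sliceRight_T₄ hε hφ (K.T₁.symm (x ⊗ₜ w)) z

theorem IsAntipode.apply_sliceRight_T₁ (hS : K.IsAntipode ε S) (hφ : K.IsLeftInvariant φ)
    (t : A ⊗[ℂ] A) : S (sliceRight φ (K.T₁ t)) = sliceRight φ (K.T₄ t) :=
  K.eq_of_mul_right fun z => by rw [mul_sliceRight_T₄ hS.counit hφ, hS.mul_apply]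

theorem IsAntipode.apply_sliceLeft_T₂ (hS : K.IsAntipode ε S) (hψ : K.IsRightInvariant ψ)
    (t : A ⊗[ℂ] A) : S (sliceLeft ψ (K.T₂ t)) = sliceLeft ψ (K.T₃ t) := by
  simpa [CanonicalMaps.opCop] using
    hS.opCop.apply_sliceRight_T₁ hψ.opCop (TensorProduct.comm ℂ A A t)

theorem left_apply_T₁ (p : A) (t : A ⊗[ℂ] A) :
    K.left p (K.T₁ t) = K.T₁ ((K.mul p).rTensor A t) := by
  induction t with
  | zero => simp
  | add s t hs ht => simp only [map_add, hs, ht]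
  | tmul b c => rw [K.left_T₁]; simp

theorem T₁_symm_rTensor_flip_mul_T₁ (y p q : A) :
    K.T₁.symm ((K.mul.flip y).rTensor A (K.T₁ (p ⊗ₜ q))) =
      (K.mul p).rTensor A (K.T₁.symm (y ⊗ₜ q)) := by
  rw [LinearEquiv.symm_apply_eq, ← left_apply_T₁, LinearEquiv.apply_symm_apply, K.left_tmul₁]

theorem IsCounit.sliceLeft_rTensor_mul (hε : K.IsCounit ε) (p : A) (t : A ⊗[ℂ] A) :
    sliceLeft ε ((K.mul p).rTensor A t) = ε p • sliceLeft ε t := by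
  induction t <;> simp_all [hε.map_mul, mul_smul]

theorem IsAntipode.sliceLeft_T₁_symm (hS : K.IsAntipode ε S) (y : A) (s : A ⊗[ℂ] A) :
    sliceLeft ε (K.T₁.symm ((K.mul.flip y).rTensor A (K.T₁ s))) =
      K.mul (S y) (sliceLeft ε s) := by
  induction s with
  | zero => simp
  | add s t hs ht => simp only [map_add, hs, ht]
  | tmul p q =>
    rw [T₁_symm_rTensor_flip_mul_T₁, hS.counit.sliceLeft_rTensor_mul, ← hS.mul_apply]
    simp

theorem IsAntipode.map_mul (hS : K.IsAntipode ε S) (x y : A) :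
    S (K.mul x y) = K.mul (S y) (S x) := by
  refine K.eq_of_mul_right fun z => ?_
  have h := hS.sliceLeft_T₁_symm y (K.T₁.symm (x ⊗ₜ z))
  rw [LinearEquiv.apply_symm_apply, ← hS.mul_apply] at h
  rw [hS.mul_apply, K.assoc, ← h]
  simp

variable (K) in
theorem exists_sliceRight_T₁_eq (hφ₀ : φ ≠ 0) (x : A) : ∃ t, sliceRight φ (K.T₁ t) = x := by
  obtain ⟨w, hw⟩ := exists_apply_eq_one hφ₀
  exact ⟨K.T₁.symm (x ⊗ₜ w), by simp [hw]⟩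

variable (K) in
theorem exists_sliceLeft_T₂_eq (hφ₀ : φ ≠ 0) (x : A) : ∃ t, sliceLeft φ (K.T₂ t) = x := by
  obtain ⟨w, hw⟩ := exists_apply_eq_one hφ₀
  exact ⟨K.T₂.symm (w ⊗ₜ x), by simp [hw]⟩

variable (K) in
theorem op_op : K.op.op = K := by
  cases K
  simp only [op, LinearMap.flip_flip, mk.injEq, true_and, and_true]
  refine ⟨?_, ?_, ?_, ?_⟩ <;> ext <;> simp

theorem IsAntipode.leftInverse_op (hS : K.IsAntipode ε S) (hS' : K.op.IsAntipode ε S')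
    (hφ : K.IsLeftInvariant φ) (hφ₀ : φ ≠ 0) : Function.LeftInverse S' S := fun x => by
  obtain ⟨t, rfl⟩ := K.exists_sliceRight_T₁_eq hφ₀ x
  rw [hS.apply_sliceRight_T₁ hφ]
  simpa [CanonicalMaps.op] using hS'.apply_sliceRight_T₁ hφ.op (TensorProduct.comm ℂ A A t)

theorem IsAntipode.rightInverse_op (hS : K.IsAntipode ε S) (hS' : K.op.IsAntipode ε S')
    (hφ : K.IsLeftInvariant φ) (hφ₀ : φ ≠ 0) : Function.RightInverse S' S :=
  hS'.leftInverse_op (K.op_op.symm ▸ hS) hφ.op hφ₀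

/-! ### Faithfulness of integrals -/

theorem IsAntipode.mul'_rTensor_flip_mul (hS : K.IsAntipode ε S) (c : A) (t : A ⊗[ℂ] A) :
    K.mul' (S.rTensor A ((K.mul.flip c).rTensor A t)) = K.mul (S c) (K.mul' (S.rTensor A t)) := by
  induction t <;> simp_all [hS.map_mul, K.assoc]

theorem IsAntipode.T₃ (hS : K.IsAntipode ε S) (a c : A) :
    K.mul' (S.rTensor A (K.T₃ (a ⊗ₜ c))) = ε a • S c := by
  refine K.eq_of_mul_right fun z => ?_
  rw [← mul'_lTensor_flip_mul, lTensor_rTensor, ← K.left_tmul₃, K.left_tmul₁,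
    hS.mul'_rTensor_flip_mul, hS.T₁]
  simp

theorem IsAntipode.apply_mul_sliceLeft_T₃_eq_zero (hS : K.IsAntipode ε S)
    (hφ : K.IsLeftInvariant φ) {a : A} (ha : ∀ x, φ (K.mul x a) = 0) (g : Module.Dual ℂ A)
    (b c : A) : φ (K.mul b (sliceLeft g (K.T₃ (a ⊗ₜ c)))) = 0 := by
  have hT₁ : sliceRight φ (K.T₁ (b ⊗ₜ a)) = 0 := K.eq_zero_right _ fun d =>
    (Module.forall_dual_apply_eq_zero_iff ℂ _).1 fun f => by rw [apply_mul_sliceRight_T₁, ha]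
  rw [← apply_mul_sliceRight_T₄, ← hS.apply_sliceRight_T₁ hφ, hT₁]
  simp

theorem apply_mul'_rTensor (φ : Module.Dual ℂ A) (S : A →ₗ[ℂ] A) (b : A) (t : A ⊗[ℂ] A) :
    φ (K.mul b (K.mul' (S.rTensor A t))) =
      TensorProduct.lift (LinearMap.applyₗ ∘ₗ K.mul b ∘ₗ S)
        ((K.mul.flip.compr₂ φ).lTensor A t) := by
  induction t <;> simp_all [K.assoc]

theorem IsAntipode.counit_smul_apply_mul_eq_zero (hS : K.IsAntipode ε S)
    (hφ : K.IsLeftInvariant φ) {a : A} (ha : ∀ x, φ (K.mul x a) = 0) (b c : A) :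
    ε a • φ (K.mul b (S c)) = 0 := by
  have hT₃ : (K.mul.flip.compr₂ φ).lTensor A (K.T₃ (a ⊗ₜ c)) = 0 :=
    eq_zero_of_sliceLeft _ fun g => by
      ext b
      rw [sliceLeft_lTensor]
      exact hS.apply_mul_sliceLeft_T₃_eq_zero hφ ha g b c
  rw [← map_smul, ← map_smul, ← hS.T₃, apply_mul'_rTensor, hT₃, map_zero]

theorem IsAntipode.counit_eq_zero (hS : K.IsAntipode ε S) (hsurj : Function.Surjective S)
    (hφ : K.IsLeftInvariant φ) (hφ₀ : φ ≠ 0) {a : A} (ha : ∀ x, φ (K.mul x a) = 0) :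
    ε a = 0 := by
  by_contra hεa
  have hmul (b c : A) : φ (K.mul b c) = 0 := by
    obtain ⟨c, rfl⟩ := hsurj c
    exact (smul_eq_zero.1 (hS.counit_smul_apply_mul_eq_zero hφ ha b c)).resolve_left hεa
  have hmul' (t : A ⊗[ℂ] A) : φ (K.mul' t) = 0 := by induction t <;> simp_all
  refine hφ₀ (LinearMap.ext fun y => ?_)
  have hy := hmul' (K.T₁.symm (a ⊗ₜ y))
  rw [← hS.counit.T₁, LinearEquiv.apply_symm_apply] at hy
  simpa [hεa] using hy

theorem IsAntipode.eq_zero_of_apply_mul (hS : K.IsAntipode ε S) (hsurj : Function.Surjective S)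
    (hφ : K.IsLeftInvariant φ) (hφ₀ : φ ≠ 0) {a : A} (ha : ∀ x, φ (K.mul x a) = 0) : a = 0 := by
  refine K.eq_zero_left _ fun c => (Module.forall_dual_apply_eq_zero_iff ℂ _).1 fun g => ?_
  rw [← mul'_tmul, ← hS.counit.T₃, apply_sliceRight]
  exact hS.counit_eq_zero hsurj hφ hφ₀ fun b => hS.apply_mul_sliceLeft_T₃_eq_zero hφ ha g b c

/-! ### The antipode and the coproduct -/

variable (K) in
/-- `(ι ⊗ f(p · ))Δ(q)`, as a linear map in `q`. -/
def sliceRightT₄ (f : Module.Dual ℂ A) (p : A) : A →ₗ[ℂ] A :=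
  sliceRight f ∘ₗ K.T₄.toLinearMap ∘ₗ TensorProduct.mk ℂ A A p

@[simp] theorem sliceRightT₄_apply (f : Module.Dual ℂ A) (p q : A) :
    K.sliceRightT₄ f p q = sliceRight f (K.T₄ (p ⊗ₜ q)) := rfl

theorem T₃_sliceRightT₄_tmul (f : Module.Dual ℂ A) (p q c : A) :
    K.T₃ (K.sliceRightT₄ f p q ⊗ₜ c) = (K.sliceRightT₄ f p).lTensor A (K.T₃ (q ⊗ₜ c)) :=
  ext_sliceLeft fun g => by simp [sliceLeft_lTensor, K.coassoc₃₄]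

theorem IsAntipode.apply_mul_sliceRight_mul (hS : K.IsAntipode ε S) (hφ : K.IsLeftInvariant φ)
    (f : Module.Dual ℂ A) (p v d : A) :
    f (K.mul (sliceRight φ (K.T₄ (p ⊗ₜ v))) (S d)) =
      φ (K.mul (sliceLeft (f ∘ₗ S) (K.T₂ (d ⊗ₜ p))) v) := by
  rw [← hS.apply_sliceRight_T₁ hφ, ← hS.map_mul, ← apply_mul_sliceRight_T₁]
  rfl

theorem IsAntipode.lTensor_T₃ (hS : K.IsAntipode ε S) (hφ : K.IsLeftInvariant φ) (hφ₀ : φ ≠ 0)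
    (x c d : A) : (K.mul.flip (S d)).lTensor A (K.T₃ (S x ⊗ₜ c)) =
      (K.mul.flip c).rTensor A
        (TensorProduct.comm ℂ A A (TensorProduct.map S S (K.T₂ (d ⊗ₜ x)))) := by
  obtain ⟨t, rfl⟩ := K.exists_sliceRight_T₁_eq hφ₀ x
  induction t with
  | zero => simp
  | add s t hs ht =>
    simp only [map_add, TensorProduct.add_tmul, TensorProduct.tmul_add, hs, ht]
  | tmul p q =>
    refine ext_sliceRight fun f => ?_
    have hf : (f ∘ₗ K.mul.flip (S d)) ∘ₗ K.sliceRightT₄ φ p =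
        φ ∘ₗ K.mul (sliceLeft (f ∘ₗ S) (K.T₂ (d ⊗ₜ p))) :=
      LinearMap.ext fun v => hS.apply_mul_sliceRight_mul hφ f p v d
    rw [hS.apply_sliceRight_T₁ hφ, ← sliceRightT₄_apply, T₃_sliceRightT₄_tmul, sliceRight_lTensor,
      sliceRight_lTensor, hf, ← sliceRight_lTensor, ← K.T₄_T₃, sliceRight_rTensor,
      sliceRight_rTensor, sliceRight_comm, sliceLeft_map, K.coassoc₁₂, hS.apply_sliceRight_T₁ hφ]

theorem IsAntipode.rTensor_comm_map (hS : K.IsAntipode ε S) (c : A) (t : A ⊗[ℂ] A) :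
    (K.mul.flip (S c)).rTensor A (TensorProduct.comm ℂ A A (TensorProduct.map S S t)) =
      TensorProduct.comm ℂ A A (TensorProduct.map S S ((K.mul c).lTensor A t)) := by
  induction t <;> simp_all [hS.map_mul]

theorem IsAntipode.lTensor_comm_map (hS : K.IsAntipode ε S) (d : A) (t : A ⊗[ℂ] A) :
    (K.mul.flip (S d)).lTensor A (TensorProduct.comm ℂ A A (TensorProduct.map S S t)) =
      TensorProduct.comm ℂ A A (TensorProduct.map S S ((K.mul d).rTensor A t)) := by
  induction t <;> simp_all [hS.map_mul]

/-- This is `Δ(S(x)) = σ(S ⊗ S)Δ(x)`, with one leg covered. -/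
theorem IsAntipode.T₃_tmul (hS : K.IsAntipode ε S) (hsurj : Function.Surjective S)
    (hφ : K.IsLeftInvariant φ) (hφ₀ : φ ≠ 0) (x c : A) : K.T₃ (S x ⊗ₜ S c) =
      TensorProduct.comm ℂ A A (TensorProduct.map S S (K.T₄ (c ⊗ₜ x))) := by
  refine K.eq_of_lTensor_flip_mul fun d => ?_
  obtain ⟨d, rfl⟩ := hsurj d
  rw [hS.lTensor_T₃ hφ hφ₀, hS.rTensor_comm_map, hS.lTensor_comm_map, ← K.right_tmul₂,
    K.right_tmul₄]

theorem IsAntipode.isRightInvariant (hS : K.IsAntipode ε S) (hbij : Function.Bijective S)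
    (hφ : K.IsLeftInvariant φ) (hφ₀ : φ ≠ 0) : K.IsRightInvariant (φ ∘ₗ S) := by
  have hT₄ (a b : A) : sliceLeft (φ ∘ₗ S) (K.T₄ (b ⊗ₜ a)) = (φ ∘ₗ S) a • b := by
    apply hbij.1
    rw [← sliceLeft_map, ← sliceRight_comm, ← hS.T₃_tmul hbij.2 hφ hφ₀, hφ.T₃, map_smul]
    rfl
  refine ⟨fun a b => K.eq_of_mul_left fun d => ?_, hT₄⟩
  rw [← sliceLeft_lTensor, ← K.T₄_T₁, sliceLeft_lTensor, hT₄]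
  simp

/-! ### Comparison of the functionals given by integrals -/

theorem IsRightInvariant.sliceLeft_left_T₁ (hψ : K.IsRightInvariant ψ) (x : A) (t : A ⊗[ℂ] A) :
    sliceLeft ψ (K.left x (K.T₁ t)) = sliceLeft (ψ ∘ₗ K.mul x) t := by
  induction t with
  | zero => simp
  | add s t hs ht => simp only [map_add, hs, ht]
  | tmul p q => rw [K.left_T₁, hψ.T₁]; simp

theorem IsRightInvariant.sliceLeft_right_T₄ (hψ : K.IsRightInvariant ψ) (x : A) (t : A ⊗[ℂ] A) :
    sliceLeft ψ (K.right x (K.T₄ t)) = sliceRight (ψ ∘ₗ K.mul.flip x) t := by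
  induction t with
  | zero => simp
  | add s t hs ht => simp only [map_add, hs, ht]
  | tmul p q => rw [K.right_T₄, hψ.T₄]; simp

theorem IsLeftInvariant.sliceRight_left_T₃ (hφ : K.IsLeftInvariant φ) (x : A) (t : A ⊗[ℂ] A) :
    sliceRight φ (K.left x (K.T₃ t)) = sliceLeft (φ ∘ₗ K.mul x) t := by
  induction t with
  | zero => simp
  | add s t hs ht => simp only [map_add, hs, ht]
  | tmul p q => rw [K.left_T₃, hφ.T₃]; simp

theorem apply_mul_sliceRight_eq (hφ : K.IsLeftInvariant φ) (hψ : K.IsRightInvariant ψ)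
    {s t : A ⊗[ℂ] A} (h : K.T₁ s = K.T₃ t) (x : A) :
    ψ (K.mul x (sliceRight φ s)) = φ (K.mul x (sliceRight ψ t)) :=
  calc ψ (K.mul x (sliceRight φ s))
      = φ (sliceLeft ψ (K.left x (K.T₁ s))) := by
        rw [hψ.sliceLeft_left_T₁, ← apply_sliceRight]; rfl
    _ = ψ (sliceRight φ (K.left x (K.T₃ t))) := by rw [h, apply_sliceRight]
    _ = φ (K.mul x (sliceRight ψ t)) := by
        rw [hφ.sliceRight_left_T₃, ← apply_sliceRight]; rfl

theorem exists_right_mul_eq_right_mul (hφ : K.IsLeftInvariant φ) (hψ : K.IsRightInvariant ψ)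
    (hψ₀ : ψ ≠ 0) (p : A) : ∃ p', ∀ x, φ (K.mul x p) = ψ (K.mul x p') := by
  obtain ⟨w, hw⟩ := exists_apply_eq_one hψ₀
  refine ⟨sliceRight φ (K.T₁.symm (K.T₃ (p ⊗ₜ w))), fun x => ?_⟩
  rw [apply_mul_sliceRight_eq hφ hψ (K.T₁.apply_symm_apply _)]
  simp [hw]

theorem exists_right_mul_eq_right_mul' (hφ : K.IsLeftInvariant φ) (hφ₀ : φ ≠ 0)
    (hψ : K.IsRightInvariant ψ) (p : A) : ∃ p', ∀ x, ψ (K.mul x p) = φ (K.mul x p') := by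
  obtain ⟨w, hw⟩ := exists_apply_eq_one hφ₀
  refine ⟨sliceRight ψ (K.T₃.symm (K.T₁ (p ⊗ₜ w))), fun x => ?_⟩
  rw [← apply_mul_sliceRight_eq hφ hψ (K.T₃.apply_symm_apply _).symm]
  simp [hw]

theorem IsAntipode.apply_sliceLeft_T₂_mul (hS : K.IsAntipode ε S) (hl : Function.LeftInverse S' S)
    (hr : Function.RightInverse S' S) (hφ : K.IsLeftInvariant φ)
    (hψ : K.IsRightInvariant (φ ∘ₗ S')) (d a x : A) :
    φ (K.mul (sliceLeft φ (K.T₂ (d ⊗ₜ a))) x) =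
      (φ ∘ₗ S') (K.mul x (sliceRight (φ ∘ₗ S) (K.T₁ (S d ⊗ₜ S' a)))) :=
  calc φ (K.mul (sliceLeft φ (K.T₂ (d ⊗ₜ a))) x)
      = φ (K.mul d (sliceRight φ (K.T₁ (a ⊗ₜ x)))) := (apply_mul_sliceRight_T₁ ..).symm
    _ = (φ ∘ₗ S') (K.mul (sliceRight φ (K.T₄ (a ⊗ₜ x))) (S d)) := by
      rw [← hS.apply_sliceRight_T₁ hφ, ← hS.map_mul, LinearMap.comp_apply, hl]
    _ = φ (K.mul a (sliceLeft (φ ∘ₗ S') (K.T₃ (x ⊗ₜ S d)))) := apply_mul_sliceRight_T₄ ..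
    _ = (φ ∘ₗ S) (K.mul (sliceLeft (φ ∘ₗ S') (K.T₂ (x ⊗ₜ S d))) (S' a)) := by
      rw [← hS.apply_sliceLeft_T₂ hψ, LinearMap.comp_apply, hS.map_mul, hr]
    _ = (φ ∘ₗ S') (K.mul x (sliceRight (φ ∘ₗ S) (K.T₁ (S d ⊗ₜ S' a)))) :=
      (apply_mul_sliceRight_T₁ ..).symm

theorem IsAntipode.exists_left_mul_eq_right_mul (hS : K.IsAntipode ε S)
    (hS' : K.op.IsAntipode ε S') (hφ : K.IsLeftInvariant φ) (hφ₀ : φ ≠ 0) (p : A) :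
    ∃ p', ∀ x, φ (K.mul p x) = φ (K.mul x p') := by
  have hl := hS.leftInverse_op hS' hφ hφ₀
  have hr := hS.rightInverse_op hS' hφ hφ₀
  have hψ : K.IsRightInvariant (φ ∘ₗ S') :=
    K.op_op ▸ (hS'.isRightInvariant ⟨hr.injective, hl.surjective⟩ hφ.op hφ₀).op
  suffices h : ∃ z, ∀ x, φ (K.mul p x) = (φ ∘ₗ S') (K.mul x z) by
    obtain ⟨z, hz⟩ := h
    obtain ⟨p', hp'⟩ := exists_right_mul_eq_right_mul' hφ hφ₀ hψ z
    exact ⟨p', fun x => (hz x).trans (hp' x)⟩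
  obtain ⟨t, rfl⟩ := K.exists_sliceLeft_T₂_eq hφ₀ p
  induction t with
  | zero => exact ⟨0, by simp⟩
  | add s t hs ht =>
    obtain ⟨y, hy⟩ := hs
    obtain ⟨z, hz⟩ := ht
    exact ⟨y + z, fun x => by simp only [map_add, LinearMap.add_apply, hy, hz]⟩
  | tmul d a => exact ⟨_, hS.apply_sliceLeft_T₂_mul hl hr hφ hψ d a⟩

end CanonicalMaps

/-! ### Multipliers of non-degenerate algebras -/

section Nondegenerate

/-- The product of `X` is non-degenerate: only `0` annihilates `X` from either side. -/
structure Nondegenerate (X : Type*) [NonUnitalRing X] : Prop where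
  left : ∀ a : X, (∀ b, a * b = 0) → a = 0
  right : ∀ a : X, (∀ b, b * a = 0) → a = 0

theorem Nondegenerate.eq_of_mul_right {X : Type*} [NonUnitalRing X] (h : Nondegenerate X)
    {a b : X} (hab : ∀ c, a * c = b * c) : a = b :=
  sub_eq_zero.1 (h.left _ fun c => by rw [sub_mul, hab, sub_self])

theorem Nondegenerate.eq_of_mul_left {X : Type*} [NonUnitalRing X] (h : Nondegenerate X)
    {a b : X} (hab : ∀ c, c * a = c * b) : a = b :=
  sub_eq_zero.1 (h.right _ fun c => by rw [mul_sub, hab, sub_self])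

variable {X Y : Type*} [NonUnitalRing X] [Module ℂ X] [IsScalarTower ℂ X X] [SMulCommClass ℂ X X]
  [NonUnitalRing Y] [Module ℂ Y] [IsScalarTower ℂ Y Y] [SMulCommClass ℂ Y Y]

theorem Multiplier.mul_left_eq (m : Multiplier X) (x y : X) : x * m.left y = m.right x * y :=
  m.2 x y

@[simp] theorem Multiplier.of_left (x y : X) : (Multiplier.of x).left y = x * y := rfl

@[simp] theorem Multiplier.of_right (x y : X) : (Multiplier.of x).right y = y * x := rfl

@[simp] theorem Multiplier.mul_left (m n : Multiplier X) (x : X) :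
    (m * n).left x = m.left (n.left x) := rfl

@[simp] theorem Multiplier.mul_right (m n : Multiplier X) (x : X) :
    (m * n).right x = n.right (m.right x) := rfl

@[simp] theorem Multiplier.one_left (x : X) : (1 : Multiplier X).left x = x := rfl

@[simp] theorem Multiplier.one_right (x : X) : (1 : Multiplier X).right x = x := rfl

@[simp] theorem Multiplier.tmul_left (m : Multiplier X) (n : Multiplier Y) (x : X) (y : Y) :
    (Multiplier.tmul m n).left (x ⊗ₜ y) = m.left x ⊗ₜ n.left y := rfl

@[simp] theorem Multiplier.tmul_right (m : Multiplier X) (n : Multiplier Y) (x : X) (y : Y) :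
    (Multiplier.tmul m n).right (x ⊗ₜ y) = m.right x ⊗ₜ n.right y := rfl

theorem Multiplier.ext {m n : Multiplier X} (hl : ∀ x, m.left x = n.left x)
    (hr : ∀ x, m.right x = n.right x) : m = n :=
  Subtype.ext (Prod.ext (LinearMap.ext hl) (MulOpposite.unop_injective (LinearMap.ext hr)))

theorem Multiplier.tmul_one_mul_one_tmul (m : Multiplier X) (n : Multiplier Y) :
    Multiplier.tmul m 1 * Multiplier.tmul 1 n = Multiplier.tmul 1 n * Multiplier.tmul m 1 :=
  Multiplier.ext (fun t => by induction t <;> simp_all)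
    fun t => by induction t <;> simp_all

theorem Multiplier.of_tmul (x : X) (y : Y) : Multiplier.of (x ⊗ₜ[ℂ] y) =
    Multiplier.tmul (Multiplier.of x) 1 * Multiplier.tmul 1 (Multiplier.of y) :=
  Multiplier.ext (fun t => by induction t <;> simp_all [mul_add])
    fun t => by induction t <;> simp_all [add_mul]

theorem Nondegenerate.tensor (hX : Nondegenerate X) (hY : Nondegenerate Y) :
    Nondegenerate (X ⊗[ℂ] Y) where
  left t h := by
    refine eq_zero_of_lTensor (fun b : Y => LinearMap.mulRight ℂ b) hY.left t fun b => ?_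
    refine eq_zero_of_rTensor (fun a : X => LinearMap.mulRight ℂ a) hX.left _ fun a => ?_
    rw [← h (a ⊗ₜ b)]
    clear h
    induction t <;> simp_all [add_mul]
  right t h := by
    refine eq_zero_of_lTensor (fun b : Y => LinearMap.mulLeft ℂ b) hY.right t fun b => ?_
    refine eq_zero_of_rTensor (fun a : X => LinearMap.mulLeft ℂ a) hX.right _ fun a => ?_
    rw [← h (a ⊗ₜ b)]
    clear h
    induction t <;> simp_all [mul_add]

theorem Nondegenerate.of_injective (h : Nondegenerate X) :
    Function.Injective (Multiplier.of : X → Multiplier X) := fun _ _ hab =>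
  h.eq_of_mul_right fun c => congrArg (fun m : Multiplier X => m.left c) hab

theorem Nondegenerate.ext_left (h : Nondegenerate X) {m n : Multiplier X}
    (hl : ∀ x, m.left x = n.left x) : m = n :=
  Multiplier.ext hl fun x => h.eq_of_mul_right fun y => by
    rw [← m.mul_left_eq, ← n.mul_left_eq, hl]

theorem Nondegenerate.ext_right (h : Nondegenerate X) {m n : Multiplier X}
    (hr : ∀ x, m.right x = n.right x) : m = n :=
  Multiplier.ext (fun x => h.eq_of_mul_left fun y => by
    rw [m.mul_left_eq, n.mul_left_eq, hr]) hr

theorem Nondegenerate.of_left (h : Nondegenerate X) (m : Multiplier X) (x : X) :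
    Multiplier.of (m.left x) = m * Multiplier.of x :=
  h.ext_left fun y => h.eq_of_mul_left fun z => by
    rw [Multiplier.of_left, Multiplier.mul_left, Multiplier.of_left, ← mul_assoc, m.mul_left_eq,
      m.mul_left_eq, mul_assoc]

theorem Nondegenerate.of_right (h : Nondegenerate X) (m : Multiplier X) (x : X) :
    Multiplier.of (m.right x) = Multiplier.of x * m :=
  h.ext_left fun y => (m.mul_left_eq x y).symm

theorem Nondegenerate.of_rTensor_mul (h : Nondegenerate (X ⊗[ℂ] Y)) (d : X) (t : X ⊗[ℂ] Y) :
    Multiplier.of ((LinearMap.mul ℂ X d).rTensor Y t) =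
      Multiplier.tmul (Multiplier.of d) 1 * Multiplier.of t :=
  h.of_left (Multiplier.tmul (Multiplier.of d) 1) t

theorem Nondegenerate.of_lTensor_mul (h : Nondegenerate (X ⊗[ℂ] Y)) (d : Y) (t : X ⊗[ℂ] Y) :
    Multiplier.of ((LinearMap.mul ℂ Y d).lTensor X t) =
      Multiplier.tmul 1 (Multiplier.of d) * Multiplier.of t :=
  h.of_left (Multiplier.tmul 1 (Multiplier.of d)) t

theorem Nondegenerate.of_rTensor_flip_mul (h : Nondegenerate (X ⊗[ℂ] Y)) (d : X)
    (t : X ⊗[ℂ] Y) : Multiplier.of (((LinearMap.mul ℂ X).flip d).rTensor Y t) =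
      Multiplier.of t * Multiplier.tmul (Multiplier.of d) 1 :=
  h.of_right (Multiplier.tmul (Multiplier.of d) 1) t

theorem Nondegenerate.of_lTensor_flip_mul (h : Nondegenerate (X ⊗[ℂ] Y)) (d : Y)
    (t : X ⊗[ℂ] Y) : Multiplier.of (((LinearMap.mul ℂ Y).flip d).lTensor X t) =
      Multiplier.of t * Multiplier.tmul 1 (Multiplier.of d) :=
  h.of_right (Multiplier.tmul 1 (Multiplier.of d)) t

section Uniqueness

variable {Δ : X →ₗ[ℂ] Multiplier (X ⊗[ℂ] X)} {T : X ⊗[ℂ] X →ₗ[ℂ] X ⊗[ℂ] X}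
  {ε : Module.Dual ℂ X} {S S' : X →ₗ[ℂ] X}

theorem IsCounit.sliceLeft_eq_mul' (h : Nondegenerate X)
    (hT : ∀ a b, Multiplier.of (T (a ⊗ₜ b)) = Δ a * Multiplier.tmul 1 (Multiplier.of b))
    (hε : IsCounit Δ ε) (t : X ⊗[ℂ] X) : sliceLeft ε (T t) = LinearMap.mul' ℂ X t := by
  induction t with
  | zero => simp
  | add s t hs ht => simp only [map_add, hs, ht]
  | tmul a b =>
    obtain ⟨t, ht, hεt⟩ := hε.1 a b
    rw [(h.tensor h).of_injective ((hT a b).trans ht.symm), hεt, LinearMap.mul'_apply]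

theorem IsAntipode.exists_isCounit_mul'_rTensor_eq (h : Nondegenerate X)
    (hT : ∀ a b, Multiplier.of (T (a ⊗ₜ b)) = Δ a * Multiplier.tmul 1 (Multiplier.of b))
    (hS : IsAntipode Δ S) : ∃ ε, IsCounit Δ ε ∧
      ∀ t, LinearMap.mul' ℂ X (S.rTensor X (T t)) = sliceLeft ε t := by
  obtain ⟨ε, hε, hl, -⟩ := hS
  refine ⟨ε, hε, fun t => ?_⟩
  induction t with
  | zero => simp
  | add s t hs ht => simp only [map_add, hs, ht]
  | tmul a b =>
    obtain ⟨t, ht, hSt⟩ := hl a b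
    rw [(h.tensor h).of_injective ((hT a b).trans ht.symm), hSt, sliceLeft_tmul]

theorem IsAntipode.unique (h : Nondegenerate X)
    (hT : ∀ a b, Multiplier.of (T (a ⊗ₜ b)) = Δ a * Multiplier.tmul 1 (Multiplier.of b))
    (hsurj : Function.Surjective T) (hS : IsAntipode Δ S) (hS' : IsAntipode Δ S') : S = S' := by
  obtain ⟨ε, hε, hSε⟩ := hS.exists_isCounit_mul'_rTensor_eq h hT
  obtain ⟨ε', hε', hSε'⟩ := hS'.exists_isCounit_mul'_rTensor_eq h hT
  ext x
  refine h.eq_of_mul_right fun y => ?_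
  obtain ⟨t, ht⟩ := hsurj (x ⊗ₜ y)
  obtain ⟨s, rfl⟩ := hsurj t
  have hst : LinearMap.mul' ℂ X (S.rTensor X (T (T s))) =
      LinearMap.mul' ℂ X (S'.rTensor X (T (T s))) := by
    rw [hSε, hSε', hε.sliceLeft_eq_mul' h hT, hε'.sliceLeft_eq_mul' h hT]
  simpa [ht] using hst

end Uniqueness

theorem IsAntiLeft.unique {S : X →ₗ[ℂ] X} (hS : Function.Surjective S)
    (h : Nondegenerate (X ⊗[ℂ] Y)) {V W W' : Multiplier (X ⊗[ℂ] Y)} (hW : IsAntiLeft S V W)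
    (hW' : IsAntiLeft S V W') : W = W' :=
  h.ext_left fun t => by
    induction t with
    | zero => simp
    | add s t hs ht => simp only [map_add, hs, ht]
    | tmul x y =>
      obtain ⟨x, rfl⟩ := hS x
      obtain ⟨t, ht, hWt⟩ := (hW x y).1
      obtain ⟨t', ht', hWt'⟩ := (hW' x y).1
      rw [hWt, hWt', h.of_injective (ht.trans ht'.symm)]

theorem IsAntiRight.unique {S : Y →ₗ[ℂ] Y} (hS : Function.Surjective S)
    (h : Nondegenerate (X ⊗[ℂ] Y)) {V W W' : Multiplier (X ⊗[ℂ] Y)} (hW : IsAntiRight S V W)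
    (hW' : IsAntiRight S V W') : W = W' :=
  h.ext_left fun t => by
    induction t with
    | zero => simp
    | add s t hs ht => simp only [map_add, hs, ht]
    | tmul x y =>
      obtain ⟨y, rfl⟩ := hS y
      obtain ⟨t, ht, hWt⟩ := (hW x y).1
      obtain ⟨t', ht', hWt'⟩ := (hW' x y).1
      rw [hWt, hWt', h.of_injective (ht.trans ht'.symm)]

end Nondegenerate

/-! ### The canonical maps of a regular multiplier Hopf algebra -/

namespace RegularMultiplierHopfAlgebra

variable {A : Type*} [NonUnitalRing A] [Module ℂ A] [IsScalarTower ℂ A A] [SMulCommClass ℂ A A]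
  (G : RegularMultiplierHopfAlgebra A)

include G in
theorem nondegenerate : Nondegenerate A :=
  ⟨G.eq_zero_of_mul_left, G.eq_zero_of_mul_right⟩

theorem sliceLeft_assoc_rTensor_T₂ (f g : Module.Dual ℂ A) (d : A) (t : A ⊗[ℂ] A) :
    sliceRight f (sliceLeft g (TensorProduct.assoc ℂ A A A
      (G.T₂.toLinearMap.rTensor A ((TensorProduct.assoc ℂ A A A).symm (d ⊗ₜ t))))) =
      sliceLeft g (G.T₂ (d ⊗ₜ sliceRight f t)) := by
  induction t with
  | zero => simp
  | add s t hs ht => simp only [map_add, TensorProduct.tmul_add, hs, ht]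
  | tmul x y => simp [sliceLeft_assoc_tmul]

theorem sliceLeft_T₂_sliceRight_T₁ (f g : Module.Dual ℂ A) (a c d : A) :
    sliceLeft g (G.T₂ (d ⊗ₜ sliceRight f (G.T₁ (a ⊗ₜ c)))) =
      sliceRight f (G.T₁ (sliceLeft g (G.T₂ (d ⊗ₜ a)) ⊗ₜ c)) := by
  have h := congrArg (fun t => sliceRight f (sliceLeft g t)) (G.coassoc d a c)
  simp only [sliceLeft_assoc_rTensor_T₂, sliceLeft_lTensor, sliceLeft_assoc_tmul] at h
  exact h

/-- `(g ⊗ ι)(Δ(a)(d ⊗ 1))`, as a linear map in `a`. -/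
def sliceLeftT₃ (g : Module.Dual ℂ A) (d : A) : A →ₗ[ℂ] A :=
  sliceLeft g ∘ₗ G.T₃.toLinearMap ∘ₗ (TensorProduct.mk ℂ A A).flip d

theorem sliceLeft_assoc_rTensor_T₃ (g : Module.Dual ℂ A) (d : A) (t : A ⊗[ℂ] A) :
    sliceLeft g (TensorProduct.assoc ℂ A A A
      ((G.T₃.toLinearMap ∘ₗ (TensorProduct.mk ℂ A A).flip d).rTensor A t)) =
      (G.sliceLeftT₃ g d).rTensor A t := by
  induction t with
  | zero => simp
  | add s t hs ht => simp only [map_add, hs, ht]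
  | tmul x y => simp [sliceLeft_assoc_tmul, sliceLeftT₃]

theorem rTensor_sliceLeftT₃_T₁ (g : Module.Dual ℂ A) (a d e : A) :
    (G.sliceLeftT₃ g d).rTensor A (G.T₁ (a ⊗ₜ e)) = G.T₁ (G.sliceLeftT₃ g d a ⊗ₜ e) := by
  rw [← sliceLeft_assoc_rTensor_T₃, G.coassoc', sliceLeft_lTensor]
  rfl

theorem T₄_T₁ (d a c : A) : ((LinearMap.mul ℂ A).flip c).lTensor A (G.T₄ (d ⊗ₜ a)) =
    (LinearMap.mul ℂ A d).lTensor A (G.T₁ (a ⊗ₜ c)) := by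
  have h := G.nondegenerate.tensor G.nondegenerate
  apply h.of_injective
  rw [h.of_lTensor_flip_mul, h.of_lTensor_mul, G.T₄_spec, G.T₁_spec, mul_assoc]

theorem rTensor_sliceLeftT₃_T₄ (g : Module.Dual ℂ A) (a c d : A) :
    (G.sliceLeftT₃ g d).rTensor A (G.T₄ (c ⊗ₜ a)) = G.T₄ (c ⊗ₜ G.sliceLeftT₃ g d a) := by
  rw [← sub_eq_zero]
  refine eq_zero_of_lTensor (fun e : A => (LinearMap.mul ℂ A).flip e) G.eq_zero_of_mul_left _
    fun e => ?_
  rw [map_sub, sub_eq_zero, lTensor_rTensor, G.T₄_T₁, ← lTensor_rTensor,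
    G.rTensor_sliceLeftT₃_T₁, G.T₄_T₁]

/-- The canonical maps of `G`, as a `CanonicalMaps` structure over the product of `A`. -/
def canonicalMaps : CanonicalMaps A :=
  have h := G.nondegenerate.tensor G.nondegenerate
  { mul := LinearMap.mul ℂ A
    assoc := mul_assoc
    eq_zero_left := G.eq_zero_of_mul_left
    eq_zero_right := G.eq_zero_of_mul_right
    T₁ := G.T₁
    T₂ := G.T₂
    T₃ := G.T₃
    T₄ := G.T₄
    left := fun a => (G.Δ a).left
    right := fun a => (G.Δ a).right
    T₂_T₁ := fun d a c => h.of_injective <| by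
      rw [h.of_lTensor_flip_mul, h.of_rTensor_mul, G.T₂_spec, G.T₁_spec, mul_assoc]
    T₂_T₃ := G.T₂_T₃
    T₄_T₁ := G.T₄_T₁
    T₄_T₃ := fun d a c => h.of_injective <| by
      rw [h.of_rTensor_flip_mul, h.of_lTensor_mul, G.T₄_spec, G.T₃_spec, mul_assoc]
    left_tmul₁ := G.Δ_left_tmul
    left_tmul₃ := G.Δ_left_tmul'
    right_tmul₂ := fun a u v => h.of_injective <| by
      rw [h.of_right, h.of_lTensor_mul, G.T₂_spec, Multiplier.of_tmul,
        Multiplier.tmul_one_mul_one_tmul, mul_assoc]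
    right_tmul₄ := fun a u v => h.of_injective <| by
      rw [h.of_right, h.of_rTensor_mul, G.T₄_spec, Multiplier.of_tmul, mul_assoc]
    left_T₁ := fun a b c => h.of_injective <| by
      rw [h.of_left, G.T₁_spec, G.T₁_spec, LinearMap.mul_apply', map_mul, mul_assoc]
    left_T₃ := G.Δ_left_T₃
    right_T₂ := fun a b c => h.of_injective <| by
      rw [h.of_right, G.T₂_spec, G.T₂_spec, LinearMap.mul_apply', map_mul, mul_assoc]
    right_T₄ := fun a b c => h.of_injective <| by
      rw [h.of_right, G.T₄_spec, G.T₄_spec, LinearMap.mul_apply', map_mul, mul_assoc]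
    coassoc₁₂ := G.sliceLeft_T₂_sliceRight_T₁
    coassoc₃₄ := fun f g a c d => by
      have h := congrArg (sliceRight f) (G.rTensor_sliceLeftT₃_T₄ g a c d)
      rwa [sliceRight_rTensor] at h }

end RegularMultiplierHopfAlgebra

/-! ### Pairings of algebras with modules -/

section TensorPairing

variable {X Y X' Y' : Type*} [AddCommGroup X] [Module ℂ X] [AddCommGroup Y] [Module ℂ Y]
  [AddCommGroup X'] [Module ℂ X'] [AddCommGroup Y'] [Module ℂ Y']
  {p : X →ₗ[ℂ] Module.Dual ℂ Y} {q : X' →ₗ[ℂ] Module.Dual ℂ Y'}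

@[simp] theorem tensorPairing_tmul (x : X) (x' : X') (y : Y) (y' : Y') :
    tensorPairing p q (x ⊗ₜ x') (y ⊗ₜ y') = p x y * q x' y' := by
  simp [tensorPairing]

theorem tensorPairing_apply (t : X ⊗[ℂ] X') (y : Y) (y' : Y') :
    tensorPairing p q t (y ⊗ₜ y') = q (sliceLeft (p.flip y) t) y' := by
  induction t <;> simp_all

theorem tensorPairing_flip : tensorPairing p.flip q.flip = (tensorPairing p q).flip :=
  TensorProduct.ext' fun y y' => TensorProduct.ext' fun x x' => by simp

theorem injective_of_separatingLeft (hp : p.SeparatingLeft) : Function.Injective p :=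
  LinearMap.ker_eq_bot.1 (LinearMap.separatingLeft_iff_ker_eq_bot.1 hp)

theorem ext_sliceLeft_flip (hp : p.SeparatingLeft) {t t' : X ⊗[ℂ] X'}
    (h : ∀ y, sliceLeft (p.flip y) t = sliceLeft (p.flip y) t') : t = t' :=
  ext_sliceRight fun f => injective_of_separatingLeft hp <| LinearMap.ext fun y => by
    rw [← LinearMap.flip_apply p, ← LinearMap.flip_apply p, apply_sliceRight, h, apply_sliceRight]

theorem tensorPairing_separatingLeft (hp : p.SeparatingLeft) (hq : q.SeparatingLeft) :
    (tensorPairing p q).SeparatingLeft := fun t ht =>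
  ext_sliceLeft_flip hp fun y => (hq _ fun y' => by rw [← tensorPairing_apply, ht]).trans
    (map_zero _).symm

theorem tensorPairing_nondegenerate (hp : p.Nondegenerate) (hq : q.Nondegenerate) :
    (tensorPairing p q).Nondegenerate :=
  ⟨tensorPairing_separatingLeft hp.1 hq.1, LinearMap.flip_separatingLeft.1 <|
    tensorPairing_flip (p := p) (q := q) ▸ tensorPairing_separatingLeft
      (LinearMap.flip_separatingLeft.2 hp.2) (LinearMap.flip_separatingLeft.2 hq.2)⟩

end TensorPairing

/-- A non-degenerate pairing `p` of an algebra `X` with a space `Y` for which the transposes of the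
right and left multiplications of `X` exist: they are the actions `x ▷ y` and `y ◁ x` on `Y`. -/
structure ModulePairing {X Y : Type*} [NonUnitalRing X] [Module ℂ X] [AddCommGroup Y] [Module ℂ Y]
    (p : X →ₗ[ℂ] Module.Dual ℂ Y) where
  lact : X →ₗ[ℂ] Y →ₗ[ℂ] Y
  ract : X →ₗ[ℂ] Y →ₗ[ℂ] Y
  apply_lact : ∀ x' x y, p x' (lact x y) = p (x' * x) y
  apply_ract : ∀ x' x y, p x' (ract x y) = p (x * x') y
  nondegenerate : p.Nondegenerate

namespace ModulePairing

variable {X Y X' Y' : Type*} [NonUnitalRing X] [Module ℂ X] [NonUnitalRing X'] [Module ℂ X']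
  [AddCommGroup Y] [Module ℂ Y] [AddCommGroup Y'] [Module ℂ Y']
  {p : X →ₗ[ℂ] Module.Dual ℂ Y} {q : X' →ₗ[ℂ] Module.Dual ℂ Y'}

theorem ext (P : ModulePairing p) {x x' : X} (h : ∀ y, p x y = p x' y) : x = x' :=
  injective_of_separatingLeft P.nondegenerate.1 (LinearMap.ext h)

theorem ext_right (P : ModulePairing p) {y y' : Y} (h : ∀ x, p x y = p x y') : y = y' :=
  injective_of_separatingLeft (LinearMap.flip_separatingLeft.2 P.nondegenerate.2) (LinearMap.ext h)

theorem lact_ract (P : ModulePairing p) (x x' : X) (y : Y) :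
    P.lact x (P.ract x' y) = P.ract x' (P.lact x y) :=
  P.ext_right fun z => by
    rw [P.apply_lact, P.apply_ract, P.apply_ract, P.apply_lact, mul_assoc]

theorem eq_lact (P : ModulePairing p) {x : X} {y z : Y} (h : IsLeftAct p x y z) :
    z = P.lact x y :=
  P.ext_right fun x' => (h x').trans (P.apply_lact x' x y).symm

theorem eq_ract (P : ModulePairing p) {x : X} {y z : Y} (h : IsRightAct p x y z) :
    z = P.ract x y :=
  P.ext_right fun x' => (h x').trans (P.apply_ract x' x y).symm

section Multiplier

variable [IsScalarTower ℂ X X] [SMulCommClass ℂ X X] [IsScalarTower ℂ X' X']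
  [SMulCommClass ℂ X' X']

/-- The multiplier of `X` given by a functional `f` on `Y` for which the functionals `f(x ▷ · )` and
`f( · ◁ x)` are the elements `L x` and `R x` of `X`. -/
def multiplier (P : ModulePairing p) (f : Module.Dual ℂ Y) (L R : X →ₗ[ℂ] X)
    (hL : ∀ x y, f (P.lact x y) = p (L x) y) (hR : ∀ x y, f (P.ract x y) = p (R x) y) :
    Multiplier X :=
  ⟨(L, MulOpposite.op R), fun x x' => P.ext fun y => by
    change p (x * L x') y = p (R x * x') y
    rw [← P.apply_ract, ← hL, P.lact_ract, hR, P.apply_lact]⟩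

theorem isExtendedPairing_multiplier (P : ModulePairing p) {f : Module.Dual ℂ Y}
    {L R : X →ₗ[ℂ] X} (hL : ∀ x y, f (P.lact x y) = p (L x) y)
    (hR : ∀ x y, f (P.ract x y) = p (R x) y) : IsExtendedPairing p (P.multiplier f L R hL hR) f :=
  ⟨fun x y z h => by rw [P.eq_lact h, hL]; rfl, fun x y z h => by rw [P.eq_ract h, hR]; rfl⟩

theorem apply_left (P : ModulePairing p) {n : Multiplier X} {f : Module.Dual ℂ Y}
    (h : IsExtendedPairing p n f) (x : X) (y : Y) : p (n.left x) y = f (P.lact x y) :=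
  (h.1 x y _ fun x' => P.apply_lact x' x y).symm

theorem apply_right (P : ModulePairing p) {n : Multiplier X} {f : Module.Dual ℂ Y}
    (h : IsExtendedPairing p n f) (x : X) (y : Y) : p (n.right x) y = f (P.ract x y) :=
  (h.2 x y _ fun x' => P.apply_ract x' x y).symm

theorem multiplier_unique (P : ModulePairing p) {n n' : Multiplier X} {f : Module.Dual ℂ Y}
    (h : IsExtendedPairing p n f) (h' : IsExtendedPairing p n' f) : n = n' :=
  Multiplier.ext (fun x => P.ext fun y => by rw [P.apply_left h, P.apply_left h'])
    fun x => P.ext fun y => by rw [P.apply_right h, P.apply_right h']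

/-- The tensor product of two pairings; `x ⊗ x'` acts as the tensor product of the actions. -/
def tensor (P : ModulePairing p) (Q : ModulePairing q) : ModulePairing (tensorPairing p q) where
  lact := TensorProduct.homTensorHomMap _ Y Y' Y Y' ∘ₗ TensorProduct.map P.lact Q.lact
  ract := TensorProduct.homTensorHomMap _ Y Y' Y Y' ∘ₗ TensorProduct.map P.ract Q.ract
  apply_lact s t u := by
    induction s with
    | zero => simp
    | add s s' hs hs' => simp only [map_add, LinearMap.add_apply, add_mul, hs, hs']
    | tmul a a' =>
      induction t with
      | zero => simp
      | add t t' ht ht' => simp only [map_add, LinearMap.add_apply, mul_add, ht, ht']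
      | tmul x x' => induction u <;> simp_all [P.apply_lact, Q.apply_lact]
  apply_ract s t u := by
    induction s with
    | zero => simp
    | add s s' hs hs' => simp only [map_add, LinearMap.add_apply, mul_add, hs, hs']
    | tmul a a' =>
      induction t with
      | zero => simp
      | add t t' ht ht' => simp only [map_add, LinearMap.add_apply, add_mul, ht, ht']
      | tmul x x' => induction u <;> simp_all [P.apply_ract, Q.apply_ract]
  nondegenerate := tensorPairing_nondegenerate P.nondegenerate Q.nondegenerate

theorem apply_tensor_lact (P : ModulePairing p) (Q : ModulePairing q)
    {f : Module.Dual ℂ (Y ⊗[ℂ] Y')} {L : X ⊗[ℂ] X' →ₗ[ℂ] X ⊗[ℂ] X'}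
    (h : ∀ x x' y y',
      f (P.lact x y ⊗ₜ Q.lact x' y') = tensorPairing p q (L (x ⊗ₜ x')) (y ⊗ₜ y'))
    (t : X ⊗[ℂ] X') (u : Y ⊗[ℂ] Y') : f ((P.tensor Q).lact t u) = tensorPairing p q (L t) u :=
  LinearMap.congr_fun₂ (f := (P.tensor Q).lact.compr₂ f) (g := tensorPairing p q ∘ₗ L)
    (TensorProduct.ext' fun x x' => TensorProduct.ext' fun y y' => h x x' y y') t u

theorem apply_tensor_ract (P : ModulePairing p) (Q : ModulePairing q)
    {f : Module.Dual ℂ (Y ⊗[ℂ] Y')} {R : X ⊗[ℂ] X' →ₗ[ℂ] X ⊗[ℂ] X'}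
    (h : ∀ x x' y y',
      f (P.ract x y ⊗ₜ Q.ract x' y') = tensorPairing p q (R (x ⊗ₜ x')) (y ⊗ₜ y'))
    (t : X ⊗[ℂ] X') (u : Y ⊗[ℂ] Y') : f ((P.tensor Q).ract t u) = tensorPairing p q (R t) u :=
  LinearMap.congr_fun₂ (f := (P.tensor Q).ract.compr₂ f) (g := tensorPairing p q ∘ₗ R)
    (TensorProduct.ext' fun x x' => TensorProduct.ext' fun y y' => h x x' y y') t u

end Multiplier

end ModulePairing

theorem IsExtendedPairing.add {X Y : Type*} [NonUnitalRing X] [Module ℂ X] [IsScalarTower ℂ X X]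
    [SMulCommClass ℂ X X] [AddCommGroup Y] [Module ℂ Y] {p : X →ₗ[ℂ] Module.Dual ℂ Y}
    {m n : Multiplier X} {f g : Module.Dual ℂ Y} (hm : IsExtendedPairing p m f)
    (hn : IsExtendedPairing p n g) : IsExtendedPairing p (m + n) (f + g) :=
  ⟨fun x y z h => by
    change f z + g z = p (m.left x + n.left x) y
    rw [hm.1 x y z h, hn.1 x y z h, map_add, LinearMap.add_apply],
  fun x y z h => by
    change f z + g z = p (m.right x + n.right x) y
    rw [hm.2 x y z h, hn.2 x y z h, map_add, LinearMap.add_apply]⟩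

theorem IsExtendedPairing.smul {X Y : Type*} [NonUnitalRing X] [Module ℂ X] [IsScalarTower ℂ X X]
    [SMulCommClass ℂ X X] [AddCommGroup Y] [Module ℂ Y] {p : X →ₗ[ℂ] Module.Dual ℂ Y}
    (r : ℂ) {m : Multiplier X} {f : Module.Dual ℂ Y} (hm : IsExtendedPairing p m f) :
    IsExtendedPairing p (r • m) (r • f) :=
  ⟨fun x y z h => by
    change r • f z = p (r • m.left x) y
    rw [hm.1 x y z h, map_smul, LinearMap.smul_apply],
  fun x y z h => by
    change r • f z = p (r • m.right x) y
    rw [hm.2 x y z h, map_smul, LinearMap.smul_apply]⟩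

namespace AlgebraicQuantumGroup

variable {A : Type*} [NonUnitalRing A] [Module ℂ A] [IsScalarTower ℂ A A] [SMulCommClass ℂ A A]
  (G : AlgebraicQuantumGroup A)

/-! ### Antipode and right integral of an algebraic quantum group -/

theorem isLeftInvariant : G.canonicalMaps.IsLeftInvariant G.φ :=
  ⟨G.left_invariant', G.left_invariant⟩

theorem exists_isAntipode_isAntipode_op : ∃ (ε : Module.Dual ℂ A) (S S' : A →ₗ[ℂ] A),
    G.canonicalMaps.IsAntipode ε S ∧ G.canonicalMaps.op.IsAntipode ε S' := by
  obtain ⟨ε, hε⟩ := G.canonicalMaps.exists_isCounit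
  obtain ⟨S, hS⟩ := CanonicalMaps.exists_isAntipode hε G.isLeftInvariant G.φ_ne_zero
  obtain ⟨S', hS'⟩ := CanonicalMaps.exists_isAntipode hε.op G.isLeftInvariant.op G.φ_ne_zero
  exact ⟨ε, S, S', hS, hS'⟩

/-- The counit of `A`. -/
def ε : Module.Dual ℂ A := G.exists_isAntipode_isAntipode_op.choose

/-- The antipode of `A`. -/
def S : A →ₗ[ℂ] A := G.exists_isAntipode_isAntipode_op.choose_spec.choose

/-- The inverse of the antipode of `A`, which is the antipode of the opposite algebra. -/
def Sinv : A →ₗ[ℂ] A := G.exists_isAntipode_isAntipode_op.choose_spec.choose_spec.choose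

theorem isAntipode_canonicalMaps : G.canonicalMaps.IsAntipode G.ε G.S :=
  G.exists_isAntipode_isAntipode_op.choose_spec.choose_spec.choose_spec.1

theorem isAntipode_canonicalMaps_op : G.canonicalMaps.op.IsAntipode G.ε G.Sinv :=
  G.exists_isAntipode_isAntipode_op.choose_spec.choose_spec.choose_spec.2

theorem sliceLeft_ε_T₁ (t : A ⊗[ℂ] A) : sliceLeft G.ε (G.T₁ t) = LinearMap.mul' ℂ A t :=
  G.isAntipode_canonicalMaps.counit.T₁ t

theorem ε_ne_zero : G.ε ≠ 0 := fun hε => G.φ_ne_zero <| LinearMap.ext fun x => by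
  have hx : x = 0 := G.eq_zero_of_mul_left x fun y => by
    rw [← LinearMap.mul'_apply (R := ℂ), ← sliceLeft_ε_T₁, hε]
    generalize G.T₁ (x ⊗ₜ y) = t
    induction t <;> simp_all
  simp [hx]

include G in
theorem mul'_surjective : Function.Surjective (LinearMap.mul' ℂ A) := fun x => by
  obtain ⟨w, hw⟩ := exists_apply_eq_one G.ε_ne_zero
  exact ⟨G.T₁.symm (w ⊗ₜ x), by rw [← G.sliceLeft_ε_T₁]; simp [hw]⟩

@[simp] theorem Sinv_S (x : A) : G.Sinv (G.S x) = x :=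
  G.isAntipode_canonicalMaps.leftInverse_op G.isAntipode_canonicalMaps_op G.isLeftInvariant
    G.φ_ne_zero x

@[simp] theorem S_Sinv (x : A) : G.S (G.Sinv x) = x :=
  G.isAntipode_canonicalMaps.rightInverse_op G.isAntipode_canonicalMaps_op G.isLeftInvariant
    G.φ_ne_zero x

theorem S_bijective : Function.Bijective G.S :=
  ⟨Function.LeftInverse.injective G.Sinv_S, Function.RightInverse.surjective G.S_Sinv⟩

theorem Sinv_surjective : Function.Surjective G.Sinv :=
  Function.RightInverse.surjective G.Sinv_S

theorem S_mul (x y : A) : G.S (x * y) = G.S y * G.S x := G.isAntipode_canonicalMaps.map_mul x y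

theorem isAntipode_S : IsAntipode (G.Δ : A →ₗ[ℂ] Multiplier (A ⊗[ℂ] A)) G.S := by
  have h := G.isAntipode_canonicalMaps
  refine ⟨G.ε, ⟨fun a b => ⟨_, G.T₁_spec a b, ?_⟩, fun a b => ⟨_, G.T₂_spec a b, ?_⟩⟩,
    fun a b => ⟨_, G.T₁_spec a b, ?_⟩, fun a b => ⟨_, G.T₂_spec a b, ?_⟩⟩
  · exact (h.counit.T₁ (a ⊗ₜ b)).trans (CanonicalMaps.mul'_tmul ..)
  · exact (h.counit.T₂ (a ⊗ₜ b)).trans (CanonicalMaps.mul'_tmul ..)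
  · exact (h.T₁ (a ⊗ₜ b)).trans (sliceLeft_tmul ..)
  · exact (h.T₂ (a ⊗ₜ b)).trans (sliceRight_tmul ..)

theorem isThe_S : IsThe (IsAntipode (G.Δ : A →ₗ[ℂ] Multiplier (A ⊗[ℂ] A))) G.S :=
  ⟨G.isAntipode_S, fun _ h => IsAntipode.unique G.nondegenerate (T := G.T₁.toLinearMap) G.T₁_spec
    G.T₁.surjective h G.isAntipode_S⟩

theorem S_sliceRight_T₁ (t : A ⊗[ℂ] A) :
    G.S (sliceRight G.φ (G.T₁ t)) = sliceRight G.φ (G.T₄ t) :=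
  G.isAntipode_canonicalMaps.apply_sliceRight_T₁ G.isLeftInvariant t

/-- The right integral `φ ∘ S` of `A`. -/
def ψ : Module.Dual ℂ A := G.φ ∘ₗ G.S

theorem isRightInvariant : G.canonicalMaps.IsRightInvariant G.ψ :=
  G.isAntipode_canonicalMaps.isRightInvariant G.S_bijective G.isLeftInvariant G.φ_ne_zero

theorem ψ_ne_zero : G.ψ ≠ 0 := fun h => G.φ_ne_zero <| LinearMap.ext fun x => by
  simpa [ψ] using LinearMap.congr_fun h (G.Sinv x)

theorem S_sliceLeft_T₂ (t : A ⊗[ℂ] A) :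
    G.S (sliceLeft G.ψ (G.T₂ t)) = sliceLeft G.ψ (G.T₃ t) :=
  G.isAntipode_canonicalMaps.apply_sliceLeft_T₂ G.isRightInvariant t

theorem eq_zero_of_φ_mul_right {a : A} (h : ∀ x, G.φ (x * a) = 0) : a = 0 :=
  G.isAntipode_canonicalMaps.eq_zero_of_apply_mul G.S_bijective.2 G.isLeftInvariant G.φ_ne_zero h

theorem eq_zero_of_φ_mul_left {a : A} (h : ∀ x, G.φ (a * x) = 0) : a = 0 :=
  G.isAntipode_canonicalMaps_op.eq_zero_of_apply_mul G.Sinv_surjective G.isLeftInvariant.op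
    G.φ_ne_zero h

theorem eq_zero_of_ψ_mul_left {a : A} (h : ∀ x, G.ψ (a * x) = 0) : a = 0 :=
  G.S_bijective.1 <| (G.eq_zero_of_φ_mul_right fun x => by
    rw [← G.S_Sinv x, ← S_mul]; exact h _).trans (map_zero G.S).symm

theorem exists_φ_mul_left_eq (p : A) : ∃ p', ∀ x, G.φ (p * x) = G.φ (x * p') :=
  G.isAntipode_canonicalMaps.exists_left_mul_eq_right_mul G.isAntipode_canonicalMaps_op
    G.isLeftInvariant G.φ_ne_zero p

theorem exists_φ_mul_right_eq (p : A) : ∃ p', ∀ x, G.φ (x * p) = G.φ (p' * x) :=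
  G.isAntipode_canonicalMaps_op.exists_left_mul_eq_right_mul
    (G.canonicalMaps.op_op.symm ▸ G.isAntipode_canonicalMaps) G.isLeftInvariant.op G.φ_ne_zero p

theorem exists_ψ_mul_left_eq (p : A) : ∃ p', ∀ x, G.ψ (p * x) = G.φ (x * p') := by
  obtain ⟨q, hq⟩ := CanonicalMaps.exists_right_mul_eq_right_mul' G.isLeftInvariant.op G.φ_ne_zero
    G.isRightInvariant.op p
  obtain ⟨p', hp'⟩ := G.exists_φ_mul_left_eq q
  exact ⟨p', fun x => (hq x).trans (hp' x)⟩

theorem exists_φ_mul_right_eq_ψ (p : A) : ∃ p', ∀ x, G.φ (x * p) = G.ψ (p' * x) := by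
  obtain ⟨q, hq⟩ := G.exists_φ_mul_right_eq p
  obtain ⟨p', hp'⟩ := CanonicalMaps.exists_right_mul_eq_right_mul G.isLeftInvariant.op
    G.isRightInvariant.op G.ψ_ne_zero q
  exact ⟨p', fun x => (hq x).trans (hp' x)⟩

/-! ### Functionals in the dual -/

/-- The parametrization `a ↦ f a` of the dual by `A`, for a family `f` of functionals on `A` which
is injective and has the functionals `φ( · c)` as its range. -/
def dualEquivOfRange (f : A →ₗ[ℂ] Module.Dual ℂ A) (hf : ∀ a, (∀ x, f a x = 0) → a = 0)
    (hle : ∀ a, ∃ c, ∀ x, f a x = G.φ (x * c)) (hge : ∀ c, ∃ a, ∀ x, G.φ (x * c) = f a x) :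
    A ≃ₗ[ℂ] G.Dual :=
  (LinearEquiv.ofInjective f <| (injective_iff_map_eq_zero f).2 fun a ha =>
      hf a fun x => by simp [ha]) ≪≫ₗ
    LinearEquiv.ofEq (LinearMap.range f) (LinearMap.range G.fourier) (le_antisymm
      (by rintro _ ⟨a, rfl⟩; exact (hle a).imp fun c hc => LinearMap.ext fun x => (hc x).symm)
      (by rintro _ ⟨c, rfl⟩; exact (hge c).imp fun a ha => LinearMap.ext fun x => (ha x).symm))

/-- The parametrization `c ↦ φ( · c)` of the dual. -/
def φRight : A ≃ₗ[ℂ] G.Dual := G.dualEquivOfRange G.fourier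
  (fun _ => G.eq_zero_of_φ_mul_right) (fun c => ⟨c, fun _ => rfl⟩) fun c => ⟨c, fun _ => rfl⟩

/-- The parametrization `d ↦ φ(d · )` of the dual. -/
def φLeft : A ≃ₗ[ℂ] G.Dual := G.dualEquivOfRange ((LinearMap.mul ℂ A).compr₂ G.φ)
  (fun _ => G.eq_zero_of_φ_mul_left) G.exists_φ_mul_left_eq G.exists_φ_mul_right_eq

/-- The parametrization `d ↦ ψ(d · )` of the dual. -/
def ψLeft : A ≃ₗ[ℂ] G.Dual := G.dualEquivOfRange ((LinearMap.mul ℂ A).compr₂ G.ψ)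
  (fun _ => G.eq_zero_of_ψ_mul_left) G.exists_ψ_mul_left_eq G.exists_φ_mul_right_eq_ψ

@[simp] theorem ev_φRight (c x : A) : G.ev (G.φRight c) x = G.φ (x * c) := rfl

@[simp] theorem ev_φLeft (d x : A) : G.ev (G.φLeft d) x = G.φ (d * x) := rfl

@[simp] theorem ev_ψLeft (d x : A) : G.ev (G.ψLeft d) x = G.ψ (d * x) := rfl

theorem ev_nondegenerate : G.ev.Nondegenerate :=
  ⟨fun _ h => G.ev_ext fun x => (h x).trans (by simp),
    fun _ h => G.eq_zero_of_φ_mul_left fun c => h (G.φRight c)⟩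

/-! ### The actions of the dual -/

/-- The action `b ▷ x = (ι ⊗ b)Δ(x)` of `B` on `A`. -/
def lact : G.Dual →ₗ[ℂ] A →ₗ[ℂ] A :=
  (TensorProduct.mk ℂ A A).flip.compr₂ (sliceRight G.φ ∘ₗ G.T₁.toLinearMap) ∘ₗ
    G.φRight.symm.toLinearMap

/-- The action `x ◁ b = (b ⊗ ι)Δ(x)` of `B` on `A`. -/
def ract : G.Dual →ₗ[ℂ] A →ₗ[ℂ] A :=
  (TensorProduct.mk ℂ A A).flip.compr₂ (sliceLeft G.φ ∘ₗ G.T₃.toLinearMap) ∘ₗ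
    G.φRight.symm.toLinearMap

theorem lact_φRight (c x : A) : G.lact (G.φRight c) x = sliceRight G.φ (G.T₁ (x ⊗ₜ c)) := by
  simp [lact]

theorem ract_φRight (c x : A) : G.ract (G.φRight c) x = sliceLeft G.φ (G.T₃ (x ⊗ₜ c)) := by
  simp [ract]

theorem ev_lact (b' b : G.Dual) (x : A) : G.ev b' (G.lact b x) = G.ev (b' * b) x := by
  obtain ⟨c, rfl⟩ := G.φRight.surjective b
  rw [lact_φRight]
  exact ((G.ev_mul b' c x).trans (dualDistrib_apply ..)).symm

theorem ev_ract (b' b : G.Dual) (x : A) : G.ev b' (G.ract b x) = G.ev (b * b') x := by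
  obtain ⟨c, rfl⟩ := G.φRight.surjective b
  rw [ract_φRight, ← apply_sliceRight]
  exact ((G.ev_mul' c b' x).trans (dualDistrib_apply ..)).symm

/-- The pairing of the algebra `B` with the space `A`. -/
def evPairing : ModulePairing G.ev := ⟨G.lact, G.ract, G.ev_lact, G.ev_ract, G.ev_nondegenerate⟩

/-- The pairing of the algebra `A` with the space `B`; the actions of `a ∈ A` are
`φ( · c) ↦ φ( · ac)` and `φ(d · ) ↦ φ(da · )`. -/
def evFlipPairing : ModulePairing G.ev.flip where
  lact := ((LinearMap.mul ℂ A).compr₂ G.φRight.toLinearMap).compl₂ G.φRight.symm.toLinearMap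
  ract := ((LinearMap.mul ℂ A).flip.compr₂ G.φLeft.toLinearMap).compl₂ G.φLeft.symm.toLinearMap
  apply_lact x a b := by
    obtain ⟨c, rfl⟩ := G.φRight.surjective b
    simp [mul_assoc]
  apply_ract x a b := by
    obtain ⟨d, rfl⟩ := G.φLeft.surjective b
    simp [mul_assoc]
  nondegenerate := LinearMap.flip_nondegenerate.2 G.ev_nondegenerate

theorem lact_mul (b b' : G.Dual) (x : A) : G.lact (b * b') x = G.lact b (G.lact b' x) :=
  G.evPairing.ext_right fun _ => by simp only [ev_lact, mul_assoc]

theorem ract_mul (b b' : G.Dual) (x : A) : G.ract (b * b') x = G.ract b' (G.ract b x) :=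
  G.evPairing.ext_right fun _ => by simp only [ev_ract, mul_assoc]

theorem lact_ract (b b' : G.Dual) (x : A) : G.lact b (G.ract b' x) = G.ract b' (G.lact b x) :=
  G.evPairing.lact_ract b b' x

theorem lact_φLeft (d x : A) : G.lact (G.φLeft d) x = sliceRight G.φ (G.T₄ (d ⊗ₜ x)) :=
  G.evPairing.ext_right fun b => by
    obtain ⟨c, rfl⟩ := G.φRight.surjective b
    rw [ev_lact, ← ev_ract, ract_φRight]
    exact (G.canonicalMaps.apply_mul_sliceRight_T₄ G.φ G.φ c x d).symm

theorem ract_ψLeft (d x : A) : G.ract (G.ψLeft d) x = sliceLeft G.ψ (G.T₂ (d ⊗ₜ x)) :=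
  G.evPairing.ext_right fun b => by
    obtain ⟨c, rfl⟩ := G.φRight.surjective b
    rw [ev_ract, ← ev_lact, lact_φRight]
    exact G.canonicalMaps.apply_mul_sliceRight_T₁ G.ψ G.φ d x c

theorem ext_lact {N : Type*} [AddCommGroup N] [Module ℂ N] {f g : A →ₗ[ℂ] N}
    (h : ∀ b x, f (G.lact b x) = g (G.lact b x)) : f = g := by
  have hT₁ : f ∘ₗ sliceRight G.φ ∘ₗ G.T₁.toLinearMap = g ∘ₗ sliceRight G.φ ∘ₗ G.T₁.toLinearMap :=
    TensorProduct.ext' fun x c => by simpa [lact_φRight] using h (G.φRight c) x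
  ext x
  obtain ⟨t, rfl⟩ := G.canonicalMaps.exists_sliceRight_T₁_eq G.φ_ne_zero x
  exact LinearMap.congr_fun hT₁ t

theorem ext_ract {N : Type*} [AddCommGroup N] [Module ℂ N] {f g : A →ₗ[ℂ] N}
    (h : ∀ b x, f (G.ract b x) = g (G.ract b x)) : f = g := by
  have hT₃ : f ∘ₗ sliceLeft G.φ ∘ₗ G.T₃.toLinearMap = g ∘ₗ sliceLeft G.φ ∘ₗ G.T₃.toLinearMap :=
    TensorProduct.ext' fun x c => by simpa [ract_φRight] using h (G.φRight c) x
  ext x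
  obtain ⟨w, hw⟩ := exists_apply_eq_one G.φ_ne_zero
  simpa [hw] using LinearMap.congr_fun hT₃ (G.T₃.symm (w ⊗ₜ x))

theorem nondegenerate_dual : Nondegenerate G.Dual where
  left _ hb := G.ev_injective <| (G.ext_lact fun b' x => by rw [ev_lact, hb]; simp).trans
    (map_zero G.ev).symm
  right _ hb := G.ev_injective <| (G.ext_ract fun b' x => by rw [ev_ract, hb]; simp).trans
    (map_zero G.ev).symm

theorem lact_φRight_mul (c x a : A) : G.lact (G.φRight c) x * a =
    sliceLeft (G.φ ∘ₗ LinearMap.mul ℂ A x) (G.T₃.symm (a ⊗ₜ c)) := by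
  refine .trans ?_ (G.isLeftInvariant.sliceRight_left_T₃ x (G.T₃.symm (a ⊗ₜ c)))
  rw [show G.canonicalMaps.T₃ _ = a ⊗ₜ c from G.T₃.apply_symm_apply _,
    G.canonicalMaps.left_tmul₁, sliceRight_rTensor, lact_φRight]
  rfl

theorem mul_ract_ψLeft (d x a : A) : a * G.ract (G.ψLeft d) x =
    sliceRight (G.ψ ∘ₗ (LinearMap.mul ℂ A).flip x) (G.T₄.symm (d ⊗ₜ a)) := by
  refine .trans ?_ (G.isRightInvariant.sliceLeft_right_T₄ x (G.T₄.symm (d ⊗ₜ a)))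
  rw [show G.canonicalMaps.T₄ _ = d ⊗ₜ a from G.T₄.apply_symm_apply _,
    G.canonicalMaps.right_tmul₂, sliceLeft_lTensor, ract_ψLeft]
  rfl

theorem S_lact_φRight_mul (c x a : A) : G.S (G.lact (G.φRight c) x) * a =
    sliceRight (G.φ ∘ₗ LinearMap.mul ℂ A x) (G.T₃ (c ⊗ₜ a)) := by
  rw [lact_φRight, S_sliceRight_T₁, ← sliceRight_lTensor]
  refine .trans ?_ (congrArg (sliceRight G.φ) (G.canonicalMaps.T₄_T₃ x c a))
  rw [sliceRight_rTensor]
  rfl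

theorem mul_S_ract_ψLeft (d x a : A) : a * G.S (G.ract (G.ψLeft d) x) =
    sliceLeft (G.ψ ∘ₗ (LinearMap.mul ℂ A).flip x) (G.T₄ (a ⊗ₜ d)) := by
  rw [ract_ψLeft, S_sliceLeft_T₂, ← sliceLeft_rTensor]
  refine .trans ?_ (congrArg (sliceLeft G.ψ) (G.canonicalMaps.T₄_T₃ a d x)).symm
  rw [sliceLeft_lTensor]
  rfl

/-! ### The coproduct of the dual -/

/-- The map `b ⊗ b' ↦ Δ(b)(1 ⊗ b')` of `B ⊗ B`; under `c ↦ φ( · c)` it is the flip of the inverse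
of `T₃`. -/
def dualT₁ : (G.Dual ⊗[ℂ] G.Dual) ≃ₗ[ℂ] (G.Dual ⊗[ℂ] G.Dual) :=
  (TensorProduct.congr G.φRight G.φRight).symm ≪≫ₗ G.T₃.symm ≪≫ₗ TensorProduct.comm ℂ A A ≪≫ₗ
    TensorProduct.congr G.φRight G.φRight

/-- The map `b ⊗ b' ↦ (b ⊗ 1)Δ(b')` of `B ⊗ B`; under `d ↦ ψ(d · )` it is the flip of the inverse
of `T₄`. -/
def dualT₂ : (G.Dual ⊗[ℂ] G.Dual) ≃ₗ[ℂ] (G.Dual ⊗[ℂ] G.Dual) :=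
  (TensorProduct.congr G.ψLeft G.ψLeft).symm ≪≫ₗ G.T₄.symm ≪≫ₗ TensorProduct.comm ℂ A A ≪≫ₗ
    TensorProduct.congr G.ψLeft G.ψLeft

theorem dualT₁_φRight (c c' : A) : G.dualT₁ (G.φRight c ⊗ₜ G.φRight c') =
    TensorProduct.map G.φRight.toLinearMap G.φRight.toLinearMap
      (TensorProduct.comm ℂ A A (G.T₃.symm (c ⊗ₜ c'))) := by
  simp [dualT₁, TensorProduct.congr]

theorem dualT₂_ψLeft (d e : A) : G.dualT₂ (G.ψLeft d ⊗ₜ G.ψLeft e) =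
    TensorProduct.map G.ψLeft.toLinearMap G.ψLeft.toLinearMap
      (TensorProduct.comm ℂ A A (G.T₄.symm (d ⊗ₜ e))) := by
  simp [dualT₂, TensorProduct.congr]

theorem tensorPairing_dualT₁ (b b' : G.Dual) (x y : A) :
    tensorPairing G.ev G.ev (G.dualT₁ (b ⊗ₜ b')) (x ⊗ₜ y) = G.ev b (x * G.lact b' y) := by
  obtain ⟨c, rfl⟩ := G.φRight.surjective b
  obtain ⟨c', rfl⟩ := G.φRight.surjective b'
  rw [tensorPairing_apply, dualT₁_φRight, sliceLeft_map, sliceLeft_comm, ev_φRight, mul_assoc,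
    lact_φRight_mul]
  exact apply_sliceRight (G.φ ∘ₗ LinearMap.mul ℂ A y) (G.φ ∘ₗ LinearMap.mul ℂ A x) _

theorem tensorPairing_dualT₂ (b b' : G.Dual) (x y : A) :
    tensorPairing G.ev G.ev (G.dualT₂ (b ⊗ₜ b')) (x ⊗ₜ y) = G.ev b' (G.ract b x * y) := by
  obtain ⟨d, rfl⟩ := G.ψLeft.surjective b
  obtain ⟨e, rfl⟩ := G.ψLeft.surjective b'
  rw [tensorPairing_apply, dualT₂_ψLeft, sliceLeft_map, sliceLeft_comm, ev_ψLeft, ← mul_assoc,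
    mul_ract_ψLeft]
  rfl

theorem ev_flip_lact (b : G.Dual) (x : A) :
    G.ev.flip (G.lact b x) = G.ev.flip x ∘ₗ (LinearMap.mul ℂ G.Dual).flip b :=
  LinearMap.ext fun b' => G.ev_lact b' b x

theorem ev_flip_ract (b : G.Dual) (x : A) :
    G.ev.flip (G.ract b x) = G.ev.flip x ∘ₗ LinearMap.mul ℂ G.Dual b :=
  LinearMap.ext fun b' => G.ev_ract b' b x

theorem tensorPairing_rTensor_flip_mul (b : G.Dual) (t : G.Dual ⊗[ℂ] G.Dual) (x y : A) :
    tensorPairing G.ev G.ev (((LinearMap.mul ℂ G.Dual).flip b).rTensor G.Dual t) (x ⊗ₜ y) =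
      tensorPairing G.ev G.ev t (G.lact b x ⊗ₜ y) := by
  rw [tensorPairing_apply, tensorPairing_apply, sliceLeft_rTensor, ev_flip_lact]

theorem tensorPairing_lTensor_mul (b : G.Dual) (t : G.Dual ⊗[ℂ] G.Dual) (x y : A) :
    tensorPairing G.ev G.ev ((LinearMap.mul ℂ G.Dual b).lTensor G.Dual t) (x ⊗ₜ y) =
      tensorPairing G.ev G.ev t (x ⊗ₜ G.ract b y) := by
  rw [tensorPairing_apply, tensorPairing_apply, sliceLeft_lTensor, ev_ract]
  rfl

/-- The pairing of the algebra `B ⊗ B` with the space `A ⊗ A`. -/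
def evTensorPairing : ModulePairing (tensorPairing G.ev G.ev) := G.evPairing.tensor G.evPairing

/-- The map `b ⊗ b' ↦ Δ(β)(b ⊗ b')` of `B ⊗ B`. -/
def dualΔLeft (β : G.Dual) : G.Dual ⊗[ℂ] G.Dual →ₗ[ℂ] G.Dual ⊗[ℂ] G.Dual :=
  TensorProduct.lift <| (LinearMap.rTensorHom G.Dual ∘ₗ (LinearMap.mul ℂ G.Dual).flip).compl₂
    (G.dualT₁.toLinearMap ∘ₗ TensorProduct.mk ℂ _ _ β)

/-- The map `b ⊗ b' ↦ (b ⊗ b')Δ(β)` of `B ⊗ B`. -/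
def dualΔRight (β : G.Dual) : G.Dual ⊗[ℂ] G.Dual →ₗ[ℂ] G.Dual ⊗[ℂ] G.Dual :=
  TensorProduct.lift <| LinearMap.flip <|
    (LinearMap.lTensorHom G.Dual ∘ₗ LinearMap.mul ℂ G.Dual).compl₂
      (G.dualT₂.toLinearMap ∘ₗ (TensorProduct.mk ℂ _ _).flip β)

theorem tensorPairing_dualΔLeft (β : G.Dual) (t : G.Dual ⊗[ℂ] G.Dual) (u : A ⊗[ℂ] A) :
    (G.ev β ∘ₗ LinearMap.mul' ℂ A) (G.evTensorPairing.lact t u) =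
      tensorPairing G.ev G.ev (G.dualΔLeft β t) u :=
  ModulePairing.apply_tensor_lact _ _ (fun b b' x y =>
    ((G.tensorPairing_rTensor_flip_mul b _ x y).trans (G.tensorPairing_dualT₁ β b' _ y)).symm) t u

theorem tensorPairing_dualΔRight (β : G.Dual) (t : G.Dual ⊗[ℂ] G.Dual) (u : A ⊗[ℂ] A) :
    (G.ev β ∘ₗ LinearMap.mul' ℂ A) (G.evTensorPairing.ract t u) =
      tensorPairing G.ev G.ev (G.dualΔRight β t) u :=
  ModulePairing.apply_tensor_ract _ _ (fun b b' x y =>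
    ((G.tensorPairing_lTensor_mul b' _ x y).trans (G.tensorPairing_dualT₂ b β x _)).symm) t u

/-- The coproduct of the dual. -/
def dualΔ : G.Dual →ₗ[ℂ] Multiplier (G.Dual ⊗[ℂ] G.Dual) :=
  have h β := G.evTensorPairing.isExtendedPairing_multiplier
    (G.tensorPairing_dualΔLeft β) (G.tensorPairing_dualΔRight β)
  { toFun β := G.evTensorPairing.multiplier _ _ _
      (G.tensorPairing_dualΔLeft β) (G.tensorPairing_dualΔRight β)
    map_add' β β' := G.evTensorPairing.multiplier_unique (h (β + β')) <| by
      simpa only [map_add, LinearMap.add_comp] using (h β).add (h β')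
    map_smul' r β := G.evTensorPairing.multiplier_unique (h (r • β)) <| by
      simpa only [map_smul, LinearMap.smul_comp, RingHom.id_apply] using (h β).smul r }

theorem isDualCoproduct_dualΔ : G.IsDualCoproduct G.dualΔ := fun β =>
  G.evTensorPairing.isExtendedPairing_multiplier (G.tensorPairing_dualΔLeft β)
    (G.tensorPairing_dualΔRight β)

theorem isThe_dualΔ : IsThe G.IsDualCoproduct G.dualΔ :=
  ⟨G.isDualCoproduct_dualΔ, fun _ h => LinearMap.ext fun β =>
    G.evTensorPairing.multiplier_unique (h β) (G.isDualCoproduct_dualΔ β)⟩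

theorem dualT₁_spec (b b' : G.Dual) : Multiplier.of (G.dualT₁ (b ⊗ₜ b')) =
    G.dualΔ b * Multiplier.tmul 1 (Multiplier.of b') := by
  refine (G.nondegenerate_dual.tensor G.nondegenerate_dual).ext_left fun t =>
    G.evTensorPairing.ext fun u => ?_
  rw [Multiplier.of_left, Multiplier.mul_left, ← G.evTensorPairing.apply_lact,
    G.evTensorPairing.apply_left (G.isDualCoproduct_dualΔ b)]
  induction t with
  | zero => simp
  | add s t hs ht => simp only [map_add, LinearMap.add_apply, hs, ht]
  | tmul v v' =>
    induction u with
    | zero => simp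
    | add u u' hu hu' => simp only [map_add, hu, hu']
    | tmul x y =>
      exact (G.tensorPairing_dualT₁ b b' (G.lact v x) (G.lact v' y)).trans <| by
        rw [← lact_mul]
        rfl

theorem dualT₂_spec (b b' : G.Dual) : Multiplier.of (G.dualT₂ (b ⊗ₜ b')) =
    Multiplier.tmul (Multiplier.of b) 1 * G.dualΔ b' := by
  refine (G.nondegenerate_dual.tensor G.nondegenerate_dual).ext_right fun t =>
    G.evTensorPairing.ext fun u => ?_
  rw [Multiplier.of_right, Multiplier.mul_right, ← G.evTensorPairing.apply_ract,
    G.evTensorPairing.apply_right (G.isDualCoproduct_dualΔ b')]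
  induction t with
  | zero => simp
  | add s t hs ht => simp only [map_add, LinearMap.add_apply, hs, ht]
  | tmul v v' =>
    induction u with
    | zero => simp
    | add u u' hu hu' => simp only [map_add, hu, hu']
    | tmul x y =>
      exact (G.tensorPairing_dualT₂ b b' (G.ract v x) (G.ract v' y)).trans <| by
        rw [← ract_mul]
        rfl

/-! ### The antipode of the dual -/

/-- The counit of the dual, `φ( · c) ↦ φ(c)`. -/
def dualε : Module.Dual ℂ G.Dual := G.φ ∘ₗ G.φRight.symm.toLinearMap

theorem dualε_φRight (c : A) : G.dualε (G.φRight c) = G.φ c := by simp [dualε]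

theorem dualε_ract (a : A) (b : G.Dual) : G.dualε (G.evFlipPairing.ract a b) = G.ev b a := by
  obtain ⟨c, rfl⟩ := G.φRight.surjective b
  obtain ⟨a', ha'⟩ := G.φRight.surjective (G.φLeft a)
  have hφ (x : A) : G.φ (a * x) = G.φ (x * a') := (DFunLike.congr_fun (congrArg G.ev ha') x).symm
  rw [show G.evFlipPairing.ract a (G.φRight c) = G.φRight (c * a') from G.ev_ext fun x => by
      rw [← G.ev.flip_apply, G.evFlipPairing.apply_ract]
      simp [mul_assoc, hφ], dualε_φRight, ev_φRight, hφ]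

theorem dualε_ψLeft (d : A) : G.dualε (G.ψLeft d) = G.ψ d := by
  have h : G.dualε ∘ₗ G.ψLeft.toLinearMap ∘ₗ LinearMap.mul' ℂ A = G.ψ ∘ₗ LinearMap.mul' ℂ A :=
    TensorProduct.ext' fun e a => by
      have hea : G.ψLeft (e * a) = G.evFlipPairing.ract a (G.ψLeft e) := G.ev_ext fun x => by
        rw [← G.ev.flip_apply _ x, ← G.ev.flip_apply _ x, G.evFlipPairing.apply_ract]
        simp [mul_assoc]
      simp [hea, dualε_ract]
  obtain ⟨t, rfl⟩ := G.mul'_surjective d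
  exact LinearMap.congr_fun h t

/-- The antipode of the dual, `b ↦ b ∘ S`. -/
def dualS : G.Dual →ₗ[ℂ] G.Dual := G.ψLeft.toLinearMap ∘ₗ G.Sinv ∘ₗ G.φRight.symm.toLinearMap

@[simp] theorem ev_dualS (b : G.Dual) (x : A) : G.ev (G.dualS b) x = G.ev b (G.S x) := by
  obtain ⟨c, rfl⟩ := G.φRight.surjective b
  simp [dualS, ψ, S_mul]

theorem dualS_surjective : Function.Surjective G.dualS :=
  G.ψLeft.surjective.comp (G.Sinv_surjective.comp G.φRight.symm.surjective)

theorem sliceLeft_dualT₁ (b b' : G.Dual) : sliceLeft G.dualε (G.dualT₁ (b ⊗ₜ b')) = b * b' := by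
  obtain ⟨c, rfl⟩ := G.φRight.surjective b
  obtain ⟨c', rfl⟩ := G.φRight.surjective b'
  refine G.ev_ext fun x => ?_
  rw [dualT₁_φRight, sliceLeft_map, sliceLeft_comm,
    show G.dualε ∘ₗ G.φRight.toLinearMap = G.φ from LinearMap.ext G.dualε_φRight, ← ev_lact,
    ev_φRight, lact_φRight_mul]
  exact apply_sliceRight (G.φ ∘ₗ LinearMap.mul ℂ A x) G.φ _

theorem sliceRight_dualT₂ (b b' : G.Dual) : sliceRight G.dualε (G.dualT₂ (b ⊗ₜ b')) = b * b' := by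
  obtain ⟨d, rfl⟩ := G.ψLeft.surjective b
  obtain ⟨e, rfl⟩ := G.ψLeft.surjective b'
  refine G.ev_ext fun x => ?_
  rw [dualT₂_ψLeft, sliceRight_map, sliceRight_comm,
    show G.dualε ∘ₗ G.ψLeft.toLinearMap = G.ψ from LinearMap.ext G.dualε_ψLeft, ← ev_ract,
    ev_ψLeft, mul_ract_ψLeft]
  exact (apply_sliceRight G.ψ (G.ψ ∘ₗ (LinearMap.mul ℂ A).flip x) _).symm

theorem mul'_dualS_dualT₁ (b b' : G.Dual) :
    LinearMap.mul' ℂ G.Dual (G.dualS.rTensor G.Dual (G.dualT₁ (b ⊗ₜ b'))) = G.dualε b • b' := by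
  obtain ⟨c, rfl⟩ := G.φRight.surjective b
  obtain ⟨c', rfl⟩ := G.φRight.surjective b'
  refine G.ev_ext fun x => ?_
  have h : G.ev.flip x ∘ₗ LinearMap.mul' ℂ G.Dual ∘ₗ G.dualS.rTensor G.Dual ∘ₗ
      TensorProduct.map G.φRight.toLinearMap G.φRight.toLinearMap ∘ₗ
        (TensorProduct.comm ℂ A A).toLinearMap =
      G.φ ∘ₗ sliceRight (G.φ ∘ₗ LinearMap.mul ℂ A x) ∘ₗ G.T₃.toLinearMap :=
    TensorProduct.ext' fun p q => by
      simp [← S_lact_φRight_mul, ← ev_lact]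
  rw [dualT₁_φRight]
  refine (LinearMap.congr_fun h _).trans ?_
  simp [dualε_φRight, mul_comm]

theorem mul'_dualS_dualT₂ (b b' : G.Dual) :
    LinearMap.mul' ℂ G.Dual (G.dualS.lTensor G.Dual (G.dualT₂ (b ⊗ₜ b'))) = G.dualε b' • b := by
  obtain ⟨d, rfl⟩ := G.ψLeft.surjective b
  obtain ⟨e, rfl⟩ := G.ψLeft.surjective b'
  refine G.ev_ext fun x => ?_
  have h : G.ev.flip x ∘ₗ LinearMap.mul' ℂ G.Dual ∘ₗ G.dualS.lTensor G.Dual ∘ₗ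
      TensorProduct.map G.ψLeft.toLinearMap G.ψLeft.toLinearMap ∘ₗ
        (TensorProduct.comm ℂ A A).toLinearMap =
      G.ψ ∘ₗ sliceLeft (G.ψ ∘ₗ (LinearMap.mul ℂ A).flip x) ∘ₗ G.T₄.toLinearMap :=
    TensorProduct.ext' fun p q => by
      simp [← mul_S_ract_ψLeft, ← ev_ract]
  rw [dualT₂_ψLeft]
  refine (LinearMap.congr_fun h _).trans ?_
  simp [dualε_ψLeft, mul_comm]

theorem isAntipode_dualS : IsAntipode G.dualΔ G.dualS :=
  ⟨G.dualε, ⟨fun b b' => ⟨_, G.dualT₁_spec b b', G.sliceLeft_dualT₁ b b'⟩,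
    fun b b' => ⟨_, G.dualT₂_spec b b', G.sliceRight_dualT₂ b b'⟩⟩,
    fun b b' => ⟨_, G.dualT₁_spec b b', G.mul'_dualS_dualT₁ b b'⟩,
    fun b b' => ⟨_, G.dualT₂_spec b b', G.mul'_dualS_dualT₂ b b'⟩⟩

theorem isThe_dualS : IsThe (IsAntipode G.dualΔ) G.dualS :=
  ⟨G.isAntipode_dualS, fun _ h => IsAntipode.unique G.nondegenerate_dual
    (T := G.dualT₁.toLinearMap) G.dualT₁_spec G.dualT₁.surjective h G.isAntipode_dualS⟩

theorem S_lact_φRight (c x : A) : G.S (G.lact (G.φRight c) x) = G.lact (G.φLeft x) c := by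
  rw [lact_φRight, S_sliceRight_T₁, lact_φLeft]

theorem dualS_mul_φRight (b : G.Dual) (c : A) :
    G.dualS b * G.φRight c = G.φRight (G.ract b c) :=
  G.ev_ext fun x => by
    rw [← ev_lact, ev_dualS, S_lact_φRight, ev_lact, ← ev_ract, ev_φLeft, ev_φRight]

theorem ract_S (b : G.Dual) (x : A) : G.ract b (G.S x) = G.S (G.lact (G.dualS b) x) := by
  suffices h : G.ract b ∘ₗ G.S = G.S ∘ₗ G.lact (G.dualS b) from LinearMap.congr_fun h x
  refine G.ext_lact fun b' y => ?_
  obtain ⟨c, rfl⟩ := G.φRight.surjective b'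
  rw [LinearMap.comp_apply, LinearMap.comp_apply, S_lact_φRight, ← lact_ract, ← S_lact_φRight,
    ← dualS_mul_φRight, lact_mul]

theorem dualS_mul (b b' : G.Dual) : G.dualS (b * b') = G.dualS b' * G.dualS b :=
  G.ev_ext fun x => by rw [ev_dualS, ← ev_ract, ract_S, ← ev_dualS, ev_lact]

theorem lact_S (b : G.Dual) (x : A) : G.lact b (G.S x) = G.S (G.ract (G.dualS b) x) :=
  G.evPairing.ext_right fun b' => by
    rw [ev_lact, ← ev_dualS, dualS_mul, ← ev_ract, ev_dualS]

/-! ### The duality and its inverse -/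

/-- The map `b ⊗ a ↦ V(b ⊗ a)` of `B ⊗ A`; under `c ↦ φ( · c)` in the first leg it is the inverse of
`T₃`, up to a flip. -/
def Vleft : (G.Dual ⊗[ℂ] A) ≃ₗ[ℂ] (G.Dual ⊗[ℂ] A) :=
  (G.φRight.rTensor A).symm ≪≫ₗ TensorProduct.comm ℂ A A ≪≫ₗ G.T₃.symm ≪≫ₗ G.φRight.rTensor A

/-- The map `b ⊗ a ↦ (b ⊗ a)V` of `B ⊗ A`; under `d ↦ ψ(d · )` in the first leg it is the inverse of
`T₄`, up to a flip. -/
def Vright : (G.Dual ⊗[ℂ] A) ≃ₗ[ℂ] (G.Dual ⊗[ℂ] A) :=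
  (G.ψLeft.rTensor A).symm ≪≫ₗ G.T₄.symm ≪≫ₗ TensorProduct.comm ℂ A A ≪≫ₗ G.ψLeft.rTensor A

theorem sliceLeft_rTensor_φRight (x : A) (t : A ⊗[ℂ] A) :
    sliceLeft (G.ev.flip x) (G.φRight.rTensor A t) =
      sliceLeft (G.φ ∘ₗ LinearMap.mul ℂ A x) t :=
  sliceLeft_rTensor ..

theorem sliceLeft_rTensor_ψLeft (x : A) (t : A ⊗[ℂ] A) :
    sliceLeft (G.ev.flip x) (G.ψLeft.rTensor A t) =
      sliceLeft (G.ψ ∘ₗ (LinearMap.mul ℂ A).flip x) t :=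
  sliceLeft_rTensor ..

theorem sliceLeft_Vleft (b : G.Dual) (a x : A) :
    sliceLeft (G.ev.flip x) (G.Vleft (b ⊗ₜ a)) = G.lact b x * a := by
  obtain ⟨c, rfl⟩ := G.φRight.surjective b
  rw [lact_φRight_mul, ← sliceLeft_rTensor_φRight]
  simp [Vleft]

theorem sliceLeft_Vright (b : G.Dual) (a x : A) :
    sliceLeft (G.ev.flip x) (G.Vright (b ⊗ₜ a)) = a * G.ract b x := by
  obtain ⟨d, rfl⟩ := G.ψLeft.surjective b
  rw [mul_ract_ψLeft, ← sliceLeft_comm, ← sliceLeft_rTensor_ψLeft]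
  simp [Vright]

theorem sliceLeft_Vleft_symm (b : G.Dual) (a x : A) :
    sliceLeft (G.ev.flip x) (G.Vleft.symm (b ⊗ₜ a)) = G.S (G.lact b x) * a := by
  obtain ⟨c, rfl⟩ := G.φRight.surjective b
  rw [S_lact_φRight_mul, ← sliceLeft_comm, ← sliceLeft_rTensor_φRight]
  simp [Vleft]

theorem sliceLeft_Vright_symm (b : G.Dual) (a x : A) :
    sliceLeft (G.ev.flip x) (G.Vright.symm (b ⊗ₜ a)) = a * G.S (G.ract b x) := by
  obtain ⟨d, rfl⟩ := G.ψLeft.surjective b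
  rw [mul_S_ract_ψLeft, ← sliceLeft_rTensor_ψLeft]
  simp [Vright]

/-- The pairing of the algebra `B ⊗ A` with the space `A ⊗ B`. -/
def dualityPairing : ModulePairing (tensorPairing G.ev G.ev.flip) :=
  G.evPairing.tensor G.evFlipPairing

theorem lift_dualityPairing_lact (t : G.Dual ⊗[ℂ] A) (u : A ⊗[ℂ] G.Dual) :
    TensorProduct.lift G.ev.flip (G.dualityPairing.lact t u) =
      tensorPairing G.ev G.ev.flip (G.Vleft t) u :=
  ModulePairing.apply_tensor_lact (L := G.Vleft.toLinearMap) _ _ (fun b a x b' => by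
    rw [TensorProduct.lift.tmul, LinearEquiv.coe_coe, tensorPairing_apply, sliceLeft_Vleft,
      G.evFlipPairing.apply_lact]
    rfl) t u

theorem lift_dualityPairing_ract (t : G.Dual ⊗[ℂ] A) (u : A ⊗[ℂ] G.Dual) :
    TensorProduct.lift G.ev.flip (G.dualityPairing.ract t u) =
      tensorPairing G.ev G.ev.flip (G.Vright t) u :=
  ModulePairing.apply_tensor_ract (R := G.Vright.toLinearMap) _ _ (fun b a x b' => by
    rw [TensorProduct.lift.tmul, LinearEquiv.coe_coe, tensorPairing_apply, sliceLeft_Vright,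
      G.evFlipPairing.apply_ract]
    rfl) t u

/-- The duality `V ∈ M(B ⊗ A)`. -/
def V : Multiplier (G.Dual ⊗[ℂ] A) :=
  G.dualityPairing.multiplier _ G.Vleft.toLinearMap G.Vright.toLinearMap
    G.lift_dualityPairing_lact G.lift_dualityPairing_ract

theorem V_left (t : G.Dual ⊗[ℂ] A) : G.V.left t = G.Vleft t := rfl

theorem V_right (t : G.Dual ⊗[ℂ] A) : G.V.right t = G.Vright t := rfl

theorem isDuality_V : G.IsDuality G.V :=
  G.dualityPairing.isExtendedPairing_multiplier G.lift_dualityPairing_lact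
    G.lift_dualityPairing_ract

theorem isThe_V : IsThe G.IsDuality G.V :=
  ⟨G.isDuality_V, fun _ h => G.dualityPairing.multiplier_unique h G.isDuality_V⟩

/-- The inverse of the duality. -/
def W : Multiplier (G.Dual ⊗[ℂ] A) :=
  ⟨(G.Vleft.symm.toLinearMap, MulOpposite.op G.Vright.symm.toLinearMap), fun s t => by
    obtain ⟨s, rfl⟩ := G.Vright.surjective s
    obtain ⟨t, rfl⟩ := G.Vleft.surjective t
    simpa [V_left, V_right] using (G.V.mul_left_eq s t).symm⟩

theorem W_left (t : G.Dual ⊗[ℂ] A) : G.W.left t = G.Vleft.symm t := rfl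

theorem W_right (t : G.Dual ⊗[ℂ] A) : G.W.right t = G.Vright.symm t := rfl

theorem V_mul_W : G.V * G.W = 1 :=
  Multiplier.ext (fun t => by simp [V_left, W_left]) (fun t => by simp [V_right, W_right])

theorem W_mul_V : G.W * G.V = 1 :=
  Multiplier.ext (fun t => by simp [V_left, W_left]) (fun t => by simp [V_right, W_right])

/-! ### The antipodes on the legs of the duality -/

theorem nondegenerate_dual_tensor : Nondegenerate (G.Dual ⊗[ℂ] A) :=
  G.nondegenerate_dual.tensor G.nondegenerate

theorem ext_sliceLeft_ev_flip {t t' : G.Dual ⊗[ℂ] A}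
    (h : ∀ x, sliceLeft (G.ev.flip x) t = sliceLeft (G.ev.flip x) t') : t = t' :=
  ext_sliceLeft_flip G.ev_nondegenerate.1 h

theorem ext_sliceLeft_left {m n : Multiplier (G.Dual ⊗[ℂ] A)}
    (h : ∀ b a x, sliceLeft (G.ev.flip x) (m.left (b ⊗ₜ a)) =
      sliceLeft (G.ev.flip x) (n.left (b ⊗ₜ a))) : m = n :=
  G.nondegenerate_dual_tensor.ext_left fun t => LinearMap.congr_fun
    (TensorProduct.ext' fun b a => G.ext_sliceLeft_ev_flip (h b a)) t

theorem sliceLeft_mul_tmul (t : G.Dual ⊗[ℂ] A) (b : G.Dual) (a x : A) :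
    sliceLeft (G.ev.flip x) (t * (b ⊗ₜ a)) = sliceLeft (G.ev.flip (G.lact b x)) t * a := by
  induction t with
  | zero => simp
  | add s t hs ht => simp only [map_add, add_mul, hs, ht]
  | tmul b' a' => simp [ev_lact, smul_mul_assoc]

/-- The element `(b ⊗ 1)V(1 ⊗ a)` of `B ⊗ A`, read off from `(b ⊗ S(a))V⁻¹`. -/
def dualMulVMul (b : G.Dual) (a : A) : G.Dual ⊗[ℂ] A :=
  G.Sinv.lTensor G.Dual (G.W.right (b ⊗ₜ G.S a))

/-- The element `(1 ⊗ a)V(b ⊗ 1)` of `B ⊗ A`, read off from `V⁻¹(b ⊗ S(a))`. -/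
def mulVMulDual (b : G.Dual) (a : A) : G.Dual ⊗[ℂ] A :=
  G.Sinv.lTensor G.Dual (G.W.left (b ⊗ₜ G.S a))

theorem sliceLeft_dualMulVMul (b : G.Dual) (a x : A) :
    sliceLeft (G.ev.flip x) (G.dualMulVMul b a) = G.ract b x * a := by
  rw [dualMulVMul, sliceLeft_lTensor, W_right, sliceLeft_Vright_symm, ← S_mul, Sinv_S]

theorem sliceLeft_mulVMulDual (b : G.Dual) (a x : A) :
    sliceLeft (G.ev.flip x) (G.mulVMulDual b a) = a * G.lact b x := by
  rw [mulVMulDual, sliceLeft_lTensor, W_left, sliceLeft_Vleft_symm, ← S_mul, Sinv_S]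

theorem of_dualMulVMul (b : G.Dual) (a : A) : Multiplier.of (G.dualMulVMul b a) =
    Multiplier.tmul (Multiplier.of b) 1 * G.V * Multiplier.tmul 1 (Multiplier.of a) :=
  G.ext_sliceLeft_left fun b' a' x => by
    have hV : (Multiplier.tmul (Multiplier.of b) 1 * G.V * Multiplier.tmul 1 (Multiplier.of a)).left
        (b' ⊗ₜ a') = (LinearMap.mul ℂ G.Dual b).rTensor A (G.Vleft (b' ⊗ₜ (a * a'))) := rfl
    rw [hV, sliceLeft_rTensor, ← ev_flip_ract, sliceLeft_Vleft, Multiplier.of_left,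
      sliceLeft_mul_tmul, sliceLeft_dualMulVMul, lact_ract, mul_assoc]

theorem of_mulVMulDual (b : G.Dual) (a : A) : Multiplier.of (G.mulVMulDual b a) =
    Multiplier.tmul 1 (Multiplier.of a) * G.V * Multiplier.tmul (Multiplier.of b) 1 :=
  G.ext_sliceLeft_left fun b' a' x => by
    have hV : (Multiplier.tmul 1 (Multiplier.of a) * G.V * Multiplier.tmul (Multiplier.of b) 1).left
        (b' ⊗ₜ a') = (LinearMap.mul ℂ A a).lTensor G.Dual (G.Vleft ((b * b') ⊗ₜ a')) := rfl
    rw [hV, sliceLeft_lTensor, sliceLeft_Vleft, Multiplier.of_left, sliceLeft_mul_tmul,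
      sliceLeft_mulVMulDual, lact_mul, LinearMap.mul_apply', mul_assoc]

theorem sliceLeft_rTensor_dualS (t : G.Dual ⊗[ℂ] A) (x : A) :
    sliceLeft (G.ev.flip x) (G.dualS.rTensor A t) = sliceLeft (G.ev.flip (G.S x)) t := by
  rw [sliceLeft_rTensor, show G.ev.flip x ∘ₗ G.dualS = G.ev.flip (G.S x) from
    LinearMap.ext fun b => G.ev_dualS b x]

theorem W_left_dualS_tmul (b : G.Dual) (a : A) :
    G.W.left (G.dualS b ⊗ₜ a) = G.dualS.rTensor A (G.dualMulVMul b a) :=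
  G.ext_sliceLeft_ev_flip fun x => by
    rw [W_left, sliceLeft_Vleft_symm, sliceLeft_rTensor_dualS, sliceLeft_dualMulVMul, ract_S]

theorem W_right_dualS_tmul (b : G.Dual) (a : A) :
    G.W.right (G.dualS b ⊗ₜ a) = G.dualS.rTensor A (G.mulVMulDual b a) :=
  G.ext_sliceLeft_ev_flip fun x => by
    rw [W_right, sliceLeft_Vright_symm, sliceLeft_rTensor_dualS, sliceLeft_mulVMulDual, lact_S]

theorem lTensor_S_lTensor_Sinv (t : G.Dual ⊗[ℂ] A) :
    G.S.lTensor G.Dual (G.Sinv.lTensor G.Dual t) = t := by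
  induction t with
  | zero => simp
  | add s t hs ht => simp only [map_add, hs, ht]
  | tmul b a => simp

theorem isAntiLeft_W : IsAntiLeft G.dualS G.V G.W := fun b a =>
  ⟨⟨_, G.of_dualMulVMul b a, G.W_left_dualS_tmul b a⟩,
    ⟨_, G.of_mulVMulDual b a, G.W_right_dualS_tmul b a⟩⟩

theorem isAntiRight_W : IsAntiRight G.S G.V G.W := fun b a =>
  ⟨⟨_, G.of_mulVMulDual b a, (G.lTensor_S_lTensor_Sinv _).symm⟩,
    ⟨_, G.of_dualMulVMul b a, (G.lTensor_S_lTensor_Sinv _).symm⟩⟩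

theorem isThe_antiLeft : IsThe (IsAntiLeft G.dualS G.V) G.W :=
  ⟨G.isAntiLeft_W, fun _ h =>
    IsAntiLeft.unique G.dualS_surjective G.nondegenerate_dual_tensor h G.isAntiLeft_W⟩

theorem isThe_antiRight : IsThe (IsAntiRight G.S G.V) G.W :=
  ⟨G.isAntiRight_W, fun _ h =>
    IsAntiRight.unique G.S_bijective.2 G.nondegenerate_dual_tensor h G.isAntiRight_W⟩

end AlgebraicQuantumGroup

end AQG

end

open TensorProduct AQG in
theorem mainTheorem2 {A : Type*} [NonUnitalRing A] [Module ℂ A] [IsScalarTower ℂ A A]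
    [SMulCommClass ℂ A A] (G : AlgebraicQuantumGroup A) :
    ∃ (Δ' : G.Dual →ₗ[ℂ] Multiplier (G.Dual ⊗[ℂ] G.Dual))
      (S : A →ₗ[ℂ] A) (S' : G.Dual →ₗ[ℂ] G.Dual)
      (V W W' : Multiplier (G.Dual ⊗[ℂ] A)),
      IsThe G.IsDualCoproduct Δ' ∧
      IsThe (IsAntipode (G.Δ : A →ₗ[ℂ] Multiplier (A ⊗[ℂ] A))) S ∧
      IsThe (IsAntipode Δ') S' ∧
      IsThe G.IsDuality V ∧
      IsThe (IsAntiLeft S' V) W ∧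
      IsThe (IsAntiRight S V) W' ∧
      V * W = 1 ∧ W * V = 1 ∧ W = W' :=
  ⟨G.dualΔ, G.S, G.dualS, G.V, G.W, G.W, G.isThe_dualΔ, G.isThe_S, G.isThe_dualS, G.isThe_V,
    G.isThe_antiLeft, G.isThe_antiRight, G.V_mul_W, G.W_mul_V, rfl⟩
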